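/- **Corollary 4.6.** Throughout, $\mathbb N=\{1,2,\dots\}$, $[\cdot]$ is the integer part, and a *system* $(X,\mathcal B,\mu,T)$ is an invertible measure preserving transformation $T$ of a standard Borel probability space; $T^nf=f\circ T^n$ for $n\in\mathbb Z$. *Nilfactor.* For $f\in L^\infty(\mu)$ (complex valued) let $\|\!|f|\!\|_1=\|\mathbb E(f\mid\mathcal I(T))\|_{2}$, where $\mathcal I(T)$ is the $\sigma$-algebra of $T$-invariant sets, and $\|\!|f|\!\|_{k+1}^{2^{k+1}}=\lim_{N\to\infty}\frac1N\sum_{n=1}^N\|\!|\bar f\cdot T^nf|\!\|_k^{2^k}$ for $k\ge1$. Let $\mathcal Z_k$ be the factor (sub-$\sigma$-algebra of $\mathcal B$, unique up to null sets) characterized by: for $f\in L^\infty(\mu)$, $\mathbb E(f\mid\mathcal Z_{k})=0$ if and only if $\|\!|f|\!\|_{k+1}=0$. The nilfactor is $\mathcal Z=\bigvee_{k\in\mathbb N}\mathcal Z_k$; $f$ is orthogonal to $\mathcal Z$ if $\mathbb E(f\mid\mathcal Z)=0$. *$R_\ell$-property.* A real sequence $(a_N)_N$ has the $R_1$-property if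 it is bounded, all its terms are positive or all are negative, and $(|a_N|N)_N$ tends increasingly to $+\infty$. For $\ell\ge2$, sequences $(a_{1,N})_N,\dots,(a_{\ell,N})_N$ have the $R_\ell$-property if for every $1\le i\le\ell$ the sequence $(a_{i,N})_N$ has the $R_1$-property and at least one of the following holds: (a) for some $j_0\ne i$, the sequences $\big(\frac{a_{j_0,N}-a_{j,N}}{a_{i,N}}\big)_N$, $j\ne j_0$, have the $R_{\ell-1}$-property; (b) for some $j_0\neq i$, $(a_{i,N}-a_{j_0,N})_N$ has the $R_1$-property and the sequences $\big(\frac{a_{j,N}}{a_{i,N}-a_{j_0,N}}\big)_N$, $j\ne j_0$, have the $R_{\ell-1}$-property; (c) for some $j_0\ne i$ and some $k_0\ne i,j_0$, $(a_{i,N}-a_{j_0,N})_N$ has the $R_1$-property and the sequences $\big(-\frac{a_{k_0,N}}{a_{i,N}-a_{j_0,N}}\big)_N$ and $\big(\frac{a_{j,N}-a_{k_0,N}}{a_{i,N}-a_{j_0,N}}\big)_N$, $j\ne k_0,j_0$, have the $R_{\ell-1}$-property. *Super nice.* For a family $\mathcal P=\{p_1,\dots,p_\ell\}$ of real polynomials,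 $p\in\mathcal P$ and $h\in\mathbb N$, the van der Corput operation produces the family of all $p_i(t+h)-p(t)$ and $p_i(t)-p(t)$, $1\le i\le\ell$, from which the constant ones are removed and in which polynomials of degree $1$ with the same leading coefficient are replaced by one of them. A sequence $(\mathcal P_N)_N=(p_{1,N},\dots,p_{\ell,N})_N$ of $\ell$-tuples of real polynomials with bounded coefficients is *super nice* if, for all large enough $N$: (i) the polynomials $p_{i,N}$, and $p_{i,N}-p_{j,N}$ for $i\ne j$, are non-constant and their degrees do not depend on $N$; (ii) some finite number (possibly zero) of van der Corput operations (each applied only while some polynomial has degree other than $1$, with the polynomial $p$ chosen independently of $N$, and with parameters $h_1,h_2,\dots$, each large enough, possibly in terms of the preceding ones) transforms $(\mathcal P_N)_N$ into a family of $k\ge1$ polynomials of degree $1$ whose leading coefficients have the $R_k$-property for large $N$; (ii)$'$ for every $i_0$ for which $p_{i_0,N}$ has maximal degree in $\mathcal P_N$, (ii) also holds for $(p_{1,N}-p_{i_0,N},\dots,p_{i_0-1,N}-p_{i_0,N},-p_{i_0,N},p_{i_0+1,N}-p_{i_0,N},\dots,p_{\ell,N}-p_{i_0,N})_N$. **Statement.**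 Let $\ell\in\mathbb N$, let $(p_N)_N$ be a sequence of real polynomials such that $(p_N,2p_N,\dots,\ell p_N)_N$ is super nice, let $(X,\mathcal B,\mu,T)$ be a system, and suppose that at least one of the functions $f_1,\dots,f_\ell\in L^\infty(\mu)$ is orthogonal to the nilfactor $\mathcal Z$. Then $$\lim_{N\to\infty}\Big\|\frac1N\sum_{n=1}^N T^{[p_N(n)]}f_1\cdot T^{2[p_N(n)]}f_2\cdots T^{\ell[p_N(n)]}f_\ell\Big\|_{L^2(\mu)}=0 .$$ -/

import Mathlib

open MeasureTheory Filter Topology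
open scoped ENNReal ComplexConjugate

noncomputable section

/-! ## Host-Kra seminorms and nilfactors -/

section Nilfactor

variable {X : Type*} [MeasurableSpace X]

/-- The Host-Kra seminorm `‖|f|‖_k` (`k ≥ 1`) of a bounded function `f` for the transformation `T`:
`‖|f|‖_1 = ‖E(f | I(T))‖_2`, where `I(T)` is the σ-algebra of `T`-invariant sets, and
`‖|f|‖_{k+1}^{2^{k+1}} = lim_N (1/N) ∑_{n=1}^N ‖|conj f · T^n f|‖_k^{2^k}`, where `T^n f = f ∘ T^n`.
The limit exists for every measure preserving system and every bounded `f`; it is written as a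
`limsup`, which is the limit whenever the limit exists. The value at `k = 0` is not used. -/
def hkSeminorm (μ : Measure X) (T : X → X) : ℕ → (X → ℂ) → ℝ
  | 0, _ => 0
  | 1, f => Real.sqrt (∫ x, ‖(μ[f | MeasurableSpace.invariants T]) x‖ ^ 2 ∂μ)
  | k + 2, f =>
      (limsup (fun N : ℕ => (1 / (N : ℝ)) * ∑ n ∈ Finset.Icc 1 N,
        (hkSeminorm μ T (k + 1) (fun x => conj (f x) * f (T^[n] x))) ^ (2 ^ (k + 1))) atTop)
        ^ ((1 : ℝ) / 2 ^ (k + 2))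

/-- `g` is a bounded measurable function orthogonal to every `f ∈ L^∞(μ)` with `‖|f|‖_k = 0`. -/
def IsOrthogonalToNull (μ : Measure X) (T : X → X) (k : ℕ) (g : X → ℂ) : Prop :=
  Measurable g ∧ MemLp g ∞ μ ∧
    ∀ f : X → ℂ, MemLp f ∞ μ → hkSeminorm μ T k f = 0 → ∫ x, g x * f x ∂μ = 0

/-- The factor `Z_k` of the system, as a sub-σ-algebra: the one generated by all bounded measurable
functions which are orthogonal to every `f ∈ L^∞(μ)` with `‖|f|‖_{k+1} = 0`.

It is (up to null sets) the factor characterized by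
`E(f | Z_k) = 0 ↔ ‖|f|‖_{k+1} = 0` for `f ∈ L^∞(μ)`: if a sub-σ-algebra `Y` has this property, then
a bounded `g` is orthogonal to all `f` with `‖|f|‖_{k+1} = 0` if and only if `g = E(g | Y)` almost
everywhere (test with `f = conj (g - E(g | Y))`). -/
def stepNilfactor (μ : Measure X) (T : X → X) (k : ℕ) : MeasurableSpace X :=
  ⨆ g : {g : X → ℂ // IsOrthogonalToNull μ T (k + 1) g}, (borel ℂ).comap g.1

/-- The nilfactor `Z = ⋁_{k ≥ 1} Z_k` of the system. -/
def nilfactor (μ : Measure X) (T : X → X) : MeasurableSpace X :=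
  ⨆ k : ℕ, stepNilfactor μ T (k + 1)

theorem nilfactor_le (μ : Measure X) (T : X → X) : nilfactor μ T ≤ ‹MeasurableSpace X› := by
  refine iSup_le fun k => iSup_le fun g => ?_
  have h := g.2.1.comap_le
  rwa [BorelSpace.measurable_eq (α := ℂ)] at h

end Nilfactor

/-! ## The `R_ℓ`-property -/

/-- The `R_1`-property for `(a_N)_{N ≥ N₀}`: bounded, of constant strict sign, and
`(|a_N| N)_N` tends increasingly to `+∞`. -/
def R1Property (N₀ : ℕ) (a : ℕ → ℝ) : Prop :=
  (∃ C : ℝ, ∀ N, N₀ ≤ N → |a N| ≤ C) ∧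
  ((∀ N, N₀ ≤ N → 0 < a N) ∨ (∀ N, N₀ ≤ N → a N < 0)) ∧
  (∀ M N, N₀ ≤ M → M ≤ N → |a M| * M ≤ |a N| * N) ∧
  Tendsto (fun N : ℕ => |a N| * N) atTop atTop

/-- The `R_ℓ`-property for `ℓ ≥ 1` sequences indexed by `N ≥ N₀`. The family indexed by `j ≠ j₀` is
listed as `m ↦ j₀.succAbove m`. There is no `R_0`-property. -/
def RProperty (N₀ : ℕ) : (l : ℕ) → (Fin l → ℕ → ℝ) → Prop
  | 0, _ => False
  | 1, a => R1Property N₀ (a 0)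
  | l + 2, a => ∀ i : Fin (l + 2), R1Property N₀ (a i) ∧
      ((∃ j₀ : Fin (l + 2), j₀ ≠ i ∧
          RProperty N₀ (l + 1) (fun m N => (a j₀ N - a (j₀.succAbove m) N) / a i N)) ∨
       (∃ j₀ : Fin (l + 2), j₀ ≠ i ∧ R1Property N₀ (fun N => a i N - a j₀ N) ∧
          RProperty N₀ (l + 1) (fun m N => a (j₀.succAbove m) N / (a i N - a j₀ N))) ∨
       (∃ j₀ : Fin (l + 2), j₀ ≠ i ∧ R1Property N₀ (fun N => a i N - a j₀ N) ∧
          ∃ k₀ : Fin (l + 2), k₀ ≠ j₀ ∧ k₀ ≠ i ∧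
            RProperty N₀ (l + 1) (fun m N =>
              if j₀.succAbove m = k₀ then -(a k₀ N / (a i N - a j₀ N))
              else (a (j₀.succAbove m) N - a k₀ N) / (a i N - a j₀ N))))

/-! ## The van der Corput operation and super nice sequences -/

/-- A variable polynomial `(p_N)_N`. -/
abbrev PolySeq := ℕ → Polynomial ℝ

/-- The terms of `P(p_j, h)` before removing and grouping:
`p_i(t + h) - p_j(t)` and `p_i(t) - p_j(t)`. -/
def vdcTerms {l : ℕ} (P : Fin l → PolySeq) (j : Fin l) (h : ℕ) : Set PolySeq :=
  {q | ∃ i, q = (fun N => (P i N).comp (Polynomial.X + Polynomial.C (h : ℝ)) - P j N) ∨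
    q = (fun N => P i N - P j N)}

/-- A term that gets removed by the van der Corput operation: a bounded, that is constant,
polynomial for all large `N`. -/
def IsBoundedTerm (q : PolySeq) : Prop :=
  ∀ᶠ N in atTop, (q N).natDegree = 0

/-- Two terms that get identified: they are equal, or, for all large `N`, of degree `1` and with
bounded, that is constant, difference. -/
def AreGrouped (q r : PolySeq) : Prop :=
  q = r ∨ ∀ᶠ N in atTop,
    (q N).natDegree = 1 ∧ (r N).natDegree = 1 ∧ (q N - r N).natDegree = 0

/-- `Q` is a list of the family `P(p_j, h)` produced by the van der Corput operation: among the
`vdcTerms` the bounded ones are removed, and from each group one member is kept. -/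
structure IsVdcFamily {l k : ℕ} (P : Fin l → PolySeq) (j : Fin l) (h : ℕ)
    (Q : Fin k → PolySeq) : Prop where
  mem : ∀ m, Q m ∈ vdcTerms P j h
  not_bounded : ∀ m, ¬ IsBoundedTerm (Q m)
  exhaust : ∀ r ∈ vdcTerms P j h, IsBoundedTerm r ∨ ∃ m, AreGrouped r (Q m)
  distinct : ∀ m m', m ≠ m' → ¬ AreGrouped (Q m) (Q m')

/-- All members have degree `1`, for all large `N`. -/
def AllLinear {l : ℕ} (P : Fin l → PolySeq) : Prop :=
  ∀ i, ∀ᶠ N in atTop, (P i N).natDegree = 1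

/-- `s` successive van der Corput operations on `P` (each of them applied only while some
polynomial is not of degree `1`), with parameters `h_1`, then `h_2`, and so on, each of them large
enough, lead to polynomials of degree `1`, say `k` many, whose leading coefficients have the
`R_k`-property from some `N₀` on. -/
def ReducesToR : (s : ℕ) → (l : ℕ) → (Fin l → PolySeq) → Prop
  | 0, l, P => AllLinear P ∧ ∃ N₀, RProperty N₀ l (fun i N => (P i N).leadingCoeff)
  | s + 1, l, P => ¬ AllLinear P ∧ ∃ j : Fin l, ∀ᶠ h : ℕ in atTop,
      ∃ (k : ℕ) (Q : Fin k → PolySeq), IsVdcFamily P j h Q ∧ ReducesToR s k Q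

/-- Property (ii): finitely many van der Corput operations lead to degree `1` polynomials whose
leading coefficients have the `R_k`-property. -/
def HasLinearReduction {l : ℕ} (P : Fin l → PolySeq) : Prop :=
  ∃ s, ReducesToR s l P

/-- The tuple with `p_i - p_{i₀}` at `i ≠ i₀` and `-p_{i₀}` at `i₀`. -/
def flipAt {l : ℕ} (P : Fin l → PolySeq) (i₀ : Fin l) : Fin l → PolySeq :=
  fun i N => if i = i₀ then -P i₀ N else P i N - P i₀ N

/-- Super nice sequences of `l`-tuples of real polynomials. -/
structure SuperNice {l : ℕ} (P : Fin l → PolySeq) : Prop where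
  bounded_coeff : ∃ C : ℝ, ∀ i N m, |(P i N).coeff m| ≤ C
  /-- (i) for the polynomials: non-constant, of degree independent of `N` (for large `N`) -/
  degree : ∀ i, ∃ d, 0 < d ∧ ∀ᶠ N in atTop, (P i N).natDegree = d
  /-- (i) for the differences -/
  degree_sub : ∀ i j, i ≠ j → ∃ d, 0 < d ∧ ∀ᶠ N in atTop, (P i N - P j N).natDegree = d
  /-- (ii) -/
  reduction : HasLinearReduction P
  /-- (ii)' for every index of maximal degree -/
  reduction_flip : ∀ i₀, (∀ j, ∀ᶠ N in atTop, (P j N).natDegree ≤ (P i₀ N).natDegree) →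
    HasLinearReduction (flipAt P i₀)

end

/-!
The averages are controlled by van der Corput's inequality, and only two consequences of super
niceness are needed: for large `N` the degree of `p N` is a constant `d ≥ 1`, and the leading
coefficients `a N` are bounded with `|a N| * N → ∞` (`SuperNice.exists_degree`). For the second one,
each polynomial produced from `(p N, 2 p N, …)` by van der Corput operations is the image of `p N`
under a fixed linear operator commuting with differentiation. If this image has degree `1`, then its
leading coefficient is a fixed multiple of `a N`
(`leadingCoeff_map_of_commute_derivative`), so that the growth in the `R_k`-property passes to `a N`.

The central notion is `CorrLE`, an asymptotic upper bound, uniform in all functions but one, for the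
averages of the absolute values of correlations. Uniformity allows these functions to depend on `N`.
In particular the square of the norm of an average is a correlation of the given functions with the
conjugate of the average itself, which takes the exponent `0` (`tendsto_integral_sq_norm_avg`). It also
makes bounded errors in the exponents harmless, because there are only finitely many of them
(`CorrLE.of_approx`). Hence integer parts can be handled through their differences: with
`m N n = ⌊p N (n + 1)⌋`, the `k`-th differences of `m N` differ by at most `2 ^ k` from those of
`p N`, so the `d`-th differences of `m N` are bounded, and the `(d - 1)`-th ones are
`α N * n + β N + O(1)`, where `α N = d! * a N`.

The exponents are `L(Δ) m N` with integer polynomials `L` in the difference operator `Δ`. The shift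
`m N (n + r)` is `(1 + Δ) ^ r m N`, so van der Corput operations act on such families, and an operator
of order at least `d` at `0` contributes a bounded exponent. Induction on the weight of the family
(`corrLE_diffOp`) reduces the problem to multiples of the `(d - 1)`-th differences of `m N`. A change of
variables (`CorrLE.of_linear`), where `|a N| * N → ∞` is used, leads to linear exponents.

Linear correlations are controlled by the Host-Kra seminorms of the target function
(`exists_corrLE_hkSeminorm`). If they did not vanish for some `f` orthogonal to the nilfactor, the dual
functions of the averages would have a weak limit `E` with `∫ f E ≠ 0`. By the seminorm bound, `E` is
orthogonal to all bounded functions of vanishing seminorm, hence measurable with respect to the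
nilfactor, a contradiction (`corrLE_zero_of_condExp_nilfactor`).
-/

open MeasureTheory Filter Topology
open scoped ENNReal ComplexConjugate

/-! ### Van der Corput's inequality -/

theorem norm_sum_sub_sum_shift_le {z : ℕ → ℂ} {B : ℝ} (hz : ∀ n, ‖z n‖ ≤ B) (N h : ℕ) :
    ‖∑ n ∈ Finset.range N, z n - ∑ n ∈ Finset.range N, z (n + h)‖ ≤ 2 * h * B := by
  induction h with
  | zero => simp
  | succ h ih =>
    have h1 : ∑ n ∈ Finset.range N, z (n + h) - ∑ n ∈ Finset.range N, z (n + (h + 1))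
        = z h - z (N + h) := by
      rw [← Finset.sum_sub_distrib]
      have := Finset.sum_range_sub' (fun n => z (n + h)) N
      simp only [zero_add] at this
      rw [← this]
      refine Finset.sum_congr rfl fun n _ => ?_
      rw [show n + (h + 1) = n + 1 + h by ring]
    calc _ = ‖(∑ n ∈ Finset.range N, z n - ∑ n ∈ Finset.range N, z (n + h)) + (z h - z (N + h))‖ := by
            rw [← h1]; congr 1; ring
      _ ≤ 2 * h * B + (B + B) := (norm_add_le _ _).trans
            (add_le_add ih ((norm_sub_le _ _).trans (add_le_add (hz _) (hz _))))
      _ = _ := by push_cast; ring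

theorem sum_range_add_le {a : ℕ → ℝ} {B : ℝ} (ha : ∀ n, 0 ≤ a n) (hB : ∀ n, a n ≤ B) (N m : ℕ) :
    ∑ n ∈ Finset.range N, a (n + m) ≤ ∑ n ∈ Finset.range N, a n + m * B := by
  have h1 : ∑ n ∈ Finset.range N, a (n + m) ≤ ∑ n ∈ Finset.range (N + m), a n := by
    rw [add_comm N m, Finset.sum_range_add]
    simp_rw [add_comm m]
    exact le_add_of_nonneg_left (Finset.sum_nonneg fun _ _ => ha _)
  rw [Finset.sum_range_add] at h1
  refine h1.trans (add_le_add le_rfl ?_)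
  refine (Finset.sum_le_sum fun n _ => hB (N + n)).trans ?_
  simp

/-- The van der Corput trick for a bounded complex sequence: averaging over the shifts `h < H`
costs only boundary terms. -/
theorem sq_norm_sum_le_sum_shift {z : ℕ → ℂ} {B : ℝ} (hz : ∀ n, ‖z n‖ ≤ B) (N : ℕ) {H : ℕ}
    (hH : 0 < H) :
    ‖∑ n ∈ Finset.range N, z n‖ ^ 2 ≤
      2 * N / (H : ℝ) ^ 2 * ∑ n ∈ Finset.range N, ‖∑ h ∈ Finset.range H, z (n + h)‖ ^ 2
        + 8 * (H : ℝ) ^ 2 * B ^ 2 := by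
  have hB : 0 ≤ B := (norm_nonneg _).trans (hz 0)
  have hH' : (0 : ℝ) < H := by exact_mod_cast hH
  -- `W` is `H * S` up to boundary terms, and is estimated by the Cauchy-Schwarz inequality
  set S := ∑ n ∈ Finset.range N, z n with hS
  set W := ∑ n ∈ Finset.range N, ∑ h ∈ Finset.range H, z (n + h) with hW
  have h1 : ‖(H : ℂ) * S - W‖ ≤ 2 * (H : ℝ) ^ 2 * B := by
    have : (H : ℂ) * S - W =
        ∑ h ∈ Finset.range H, (S - ∑ n ∈ Finset.range N, z (n + h)) := by
      rw [Finset.sum_sub_distrib, hW, Finset.sum_comm]; simp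
    rw [this]
    refine (norm_sum_le _ _).trans ?_
    calc _ ≤ ∑ h ∈ Finset.range H, 2 * (H : ℝ) * B := by
          refine Finset.sum_le_sum fun h hh => (norm_sum_sub_sum_shift_le hz N h).trans ?_
          have : (h : ℝ) ≤ H := by exact_mod_cast (Finset.mem_range.1 hh).le
          gcongr
      _ = _ := by simp; ring
  have h2 : (H : ℝ) * ‖S‖ ≤ ‖W‖ + 2 * (H : ℝ) ^ 2 * B := by
    calc (H : ℝ) * ‖S‖ = ‖(H : ℂ) * S‖ := by simp
      _ = ‖W + ((H : ℂ) * S - W)‖ := by congr 1; ring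
      _ ≤ _ := (norm_add_le _ _).trans (add_le_add le_rfl h1)
  have h3 : ‖W‖ ^ 2 ≤ N * ∑ n ∈ Finset.range N, ‖∑ h ∈ Finset.range H, z (n + h)‖ ^ 2 := by
    calc ‖W‖ ^ 2 ≤ (∑ n ∈ Finset.range N, ‖∑ h ∈ Finset.range H, z (n + h)‖) ^ 2 := by
          gcongr; exact norm_sum_le _ _
      _ ≤ _ := by
          simpa using sq_sum_le_card_mul_sum_sq (s := Finset.range N)
            (f := fun n => ‖∑ h ∈ Finset.range H, z (n + h)‖)
  have h4 : (H : ℝ) ^ 2 * ‖S‖ ^ 2 ≤ 2 * ‖W‖ ^ 2 + 8 * (H : ℝ) ^ 4 * B ^ 2 := by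
    have h5 : ((H : ℝ) * ‖S‖) ^ 2 ≤ (‖W‖ + 2 * (H : ℝ) ^ 2 * B) ^ 2 := by gcongr
    nlinarith [sq_nonneg (‖W‖ - 2 * (H : ℝ) ^ 2 * B)]
  have h6 : ‖S‖ ^ 2 ≤ (2 * ‖W‖ ^ 2 + 8 * (H : ℝ) ^ 4 * B ^ 2) / (H : ℝ) ^ 2 := by
    rw [le_div_iff₀ (by positivity)]; linarith
  refine h6.trans ?_
  calc _ = 2 / (H : ℝ) ^ 2 * ‖W‖ ^ 2 + 8 * (H : ℝ) ^ 2 * B ^ 2 := by field_simp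
    _ ≤ 2 / (H : ℝ) ^ 2 * (N * ∑ n ∈ Finset.range N, ‖∑ h ∈ Finset.range H, z (n + h)‖ ^ 2)
        + 8 * (H : ℝ) ^ 2 * B ^ 2 := by gcongr
    _ = _ := by ring

/-- The distances `|h - h'|`, `h' < H`, take every value at most twice. -/
theorem sum_dist_le {A : ℕ → ℝ} (hA : ∀ r, 0 ≤ A r) {h H : ℕ} (hh : h < H) :
    ∑ h' ∈ Finset.range H, A ((h - h') + (h' - h)) ≤ 2 * ∑ r ∈ Finset.range H, A r := by
  have key : ∀ (s : Finset ℕ) (φ : ℕ → ℕ), Set.InjOn φ s → (∀ x ∈ s, φ x < H) →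
      ∑ x ∈ s, A (φ x) ≤ ∑ r ∈ Finset.range H, A r := by
    intro s φ hφ hs
    rw [← Finset.sum_image (f := A) hφ]
    refine Finset.sum_le_sum_of_subset_of_nonneg ?_ fun _ _ _ => hA _
    intro y hy
    obtain ⟨x, hx, rfl⟩ := Finset.mem_image.1 hy
    exact Finset.mem_range.2 (hs x hx)
  rw [← Finset.sum_filter_add_sum_filter_not _ (fun h' => h' ≤ h), two_mul]
  refine add_le_add (key _ _ ?_ ?_) (key _ _ ?_ ?_)
  · intro a ha b hb hab; simp at ha hb hab; omega
  · intro x hx; simp at hx; omega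
  · intro a ha b hb hab; simp at ha hb hab; omega
  · intro x hx; simp at hx; omega

/-- The pairs `(h, h')` are collected according to their distance; removing the shift `min h h'` in
the argument `n` costs at most `H * b` for each pair. -/
theorem sum_sum_sum_dist_le {v : ℕ → ℕ → ℝ} {b : ℝ} (hv : ∀ r n, 0 ≤ v r n)
    (hb : ∀ r n, v r n ≤ b) (N H : ℕ) :
    ∑ n ∈ Finset.range N, ∑ h ∈ Finset.range H, ∑ h' ∈ Finset.range H,
        v ((h - h') + (h' - h)) (n + min h h') ≤
      2 * H * ∑ r ∈ Finset.range H, ∑ n ∈ Finset.range N, v r n + (H : ℝ) ^ 3 * b := by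
  have hb0 : 0 ≤ b := (hv 0 0).trans (hb 0 0)
  have h1 : ∀ h ∈ Finset.range H, ∀ h' ∈ Finset.range H,
      ∑ n ∈ Finset.range N, v ((h - h') + (h' - h)) (n + min h h') ≤
        ∑ n ∈ Finset.range N, v ((h - h') + (h' - h)) n + H * b := by
    intro h hh h' _
    refine (sum_range_add_le (hv _) (hb _) N _).trans (add_le_add le_rfl ?_)
    have : ((min h h' : ℕ) : ℝ) ≤ H := by
      exact_mod_cast (min_le_left h h').trans (Finset.mem_range.1 hh).le
    exact mul_le_mul_of_nonneg_right this hb0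
  have h2 : ∀ h ∈ Finset.range H, ∑ h' ∈ Finset.range H,
      ∑ n ∈ Finset.range N, v ((h - h') + (h' - h)) (n + min h h') ≤
        2 * ∑ r ∈ Finset.range H, ∑ n ∈ Finset.range N, v r n + H * (H * b) := by
    intro h hh
    refine (Finset.sum_le_sum (h1 h hh)).trans ?_
    rw [Finset.sum_add_distrib]
    refine add_le_add (sum_dist_le (A := fun r => ∑ n ∈ Finset.range N, v r n)
      (fun r => Finset.sum_nonneg fun n _ => hv r n) (Finset.mem_range.1 hh)) ?_
    simp
  rw [Finset.sum_comm]
  refine (Finset.sum_le_sum fun h hh => (Finset.sum_comm.trans_le (h2 h hh))).trans (le_of_eq ?_)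
  rw [Finset.sum_const, Finset.card_range, nsmul_eq_mul]
  ring

section

variable {X : Type*} [MeasurableSpace X]

/-- Measurable functions bounded everywhere by `B`. -/
def BddBy (B : ℝ) (g : X → ℂ) : Prop := Measurable g ∧ ∀ x, ‖g x‖ ≤ B

theorem BddBy.integrable {B : ℝ} {g : X → ℂ} (hg : BddBy B g) (μ : Measure X)
    [IsFiniteMeasure μ] : Integrable g μ :=
  .of_bound hg.1.aestronglyMeasurable B (ae_of_all _ hg.2)

theorem BddBy.mul {B C : ℝ} {f g : X → ℂ} (hf : BddBy B f) (hg : BddBy C g) :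
    BddBy (B * C) (fun x => f x * g x) := by
  refine ⟨hf.1.mul hg.1, fun x => ?_⟩
  rw [norm_mul]
  exact mul_le_mul (hf.2 x) (hg.2 x) (norm_nonneg _) ((norm_nonneg _).trans (hf.2 x))

theorem BddBy.one_mul_one {f g : X → ℂ} (hf : BddBy 1 f) (hg : BddBy 1 g) :
    BddBy 1 (fun x => f x * g x) := by
  simpa using hf.mul hg

theorem BddBy.conj {B : ℝ} {f : X → ℂ} (hf : BddBy B f) : BddBy B (fun x => conj (f x)) :=
  ⟨Complex.continuous_conj.measurable.comp hf.1, fun x => by simpa using hf.2 x⟩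

theorem BddBy.comp {B : ℝ} {f : X → ℂ} (hf : BddBy B f) {φ : X → X} (hφ : Measurable φ) :
    BddBy B (fun x => f (φ x)) := ⟨hf.1.comp hφ, fun _ => hf.2 _⟩

theorem BddBy.prod {ι : Type*} (s : Finset ι) {g : ι → X → ℂ} (hg : ∀ i ∈ s, BddBy 1 (g i)) :
    BddBy 1 (fun x => ∏ i ∈ s, g i x) := by
  refine ⟨Finset.measurable_fun_prod s fun i hi => (hg i hi).1, fun x => ?_⟩
  rw [norm_prod]
  exact Finset.prod_le_one (fun _ _ => norm_nonneg _) fun i hi => (hg i hi).2 x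

theorem BddBy.const_mul {B c : ℝ} {f : X → ℂ} (hf : BddBy B f) {w : ℂ} (hw : ‖w‖ ≤ c) :
    BddBy (c * B) (fun x => w * f x) :=
  BddBy.mul ⟨measurable_const, fun _ => hw⟩ hf

theorem BddBy.sum {ι : Type*} (s : Finset ι) {B : ℝ} {g : ι → X → ℂ}
    (hg : ∀ i ∈ s, BddBy B (g i)) : BddBy (s.card * B) (fun x => ∑ i ∈ s, g i x) := by
  refine ⟨Finset.measurable_fun_sum s fun i hi => (hg i hi).1, fun x => ?_⟩
  refine (norm_sum_le _ _).trans ((Finset.sum_le_sum fun i hi => (hg i hi).2 x).trans ?_)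
  simp

theorem BddBy.norm_integral_le {B : ℝ} {g : X → ℂ} (hg : BddBy B g) (μ : Measure X)
    [IsProbabilityMeasure μ] : ‖∫ x, g x ∂μ‖ ≤ B := by
  simpa using norm_integral_le_of_norm_le_const (ae_of_all μ hg.2)

theorem BddBy.integrable_sq {B : ℝ} {g : X → ℂ} (hg : BddBy B g) (μ : Measure X)
    [IsFiniteMeasure μ] : Integrable (fun x => ‖g x‖ ^ 2) μ := by
  refine .of_bound (hg.1.norm.pow_const 2).aestronglyMeasurable (B ^ 2) (ae_of_all _ fun x => ?_)
  rw [Real.norm_of_nonneg (by positivity)]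
  have := hg.2 x
  gcongr

theorem sq_integral_norm_le {μ : Measure X} [IsProbabilityMeasure μ] {g : X → ℂ}
    (hg : Integrable g μ) (hg2 : Integrable (fun x => ‖g x‖ ^ 2) μ) :
    (∫ x, ‖g x‖ ∂μ) ^ 2 ≤ ∫ x, ‖g x‖ ^ 2 ∂μ := by
  set a := ∫ x, ‖g x‖ ∂μ
  have h : 0 ≤ ∫ x, (‖g x‖ - a) ^ 2 ∂μ := integral_nonneg fun x => sq_nonneg _
  have h2 : ∫ x, (‖g x‖ - a) ^ 2 ∂μ = ∫ x, ‖g x‖ ^ 2 ∂μ - a ^ 2 := by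
    have e : ∀ x, (‖g x‖ - a) ^ 2 = ‖g x‖ ^ 2 - (2 * a) * ‖g x‖ + a ^ 2 := fun x => by ring
    simp_rw [e]
    have h1 : Integrable (fun x => (2 * a) * ‖g x‖) μ := hg.norm.const_mul _
    have h3 : Integrable (fun x => ‖g x‖ ^ 2 - (2 * a) * ‖g x‖) μ := hg2.sub h1
    rw [integral_add h3 (integrable_const _), integral_sub hg2 h1, integral_const_mul]
    simp only [integral_const, probReal_univ, one_smul]
    change _ - 2 * a * a + a ^ 2 = _
    ring
  linarith

/-- Van der Corput's inequality for a bounded sequence of functions. -/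
theorem integral_sq_norm_sum_le (μ : Measure X) [IsProbabilityMeasure μ] {B : ℝ}
    {F : ℕ → X → ℂ} (hF : ∀ n, BddBy B (F n)) {N H : ℕ} (hN : 0 < N) (hH : 0 < H) :
    ∫ x, ‖(1 / (N : ℂ)) * ∑ n ∈ Finset.range N, F n x‖ ^ 2 ∂μ ≤
      4 / H * ∑ r ∈ Finset.range H,
          (1 / (N : ℝ)) * ∑ n ∈ Finset.range N, ‖∫ x, F (n + r) x * conj (F n x) ∂μ‖
        + (2 * H * B ^ 2 / N + 8 * (H : ℝ) ^ 2 * B ^ 2 / (N : ℝ) ^ 2) := by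
  have hN' : (0 : ℝ) < N := by exact_mod_cast hN
  have hH' : (0 : ℝ) < H := by exact_mod_cast hH
  set v : ℕ → ℕ → ℂ := fun r n => ∫ x, F (n + r) x * conj (F n x) ∂μ with hv
  set A : ℕ → ℝ := fun r => (1 / (N : ℝ)) * ∑ n ∈ Finset.range N, ‖v r n‖ with hA
  have hA0 : ∀ r, 0 ≤ A r := fun r => by positivity
  have hvB : ∀ r n, ‖v r n‖ ≤ B ^ 2 := fun r n => by
    have := ((hF (n + r)).mul (hF n).conj).norm_integral_le μ
    rwa [← sq] at this
  have hii : ∀ n m, Integrable (fun x => F n x * conj (F m x)) μ := fun n m =>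
    ((hF n).mul (hF m).conj).integrable μ
  have hpair : ∀ n, ∀ h h' : ℕ, (∫ x, F (n + h) x * conj (F (n + h') x) ∂μ).re ≤
      ‖v ((h - h') + (h' - h)) (n + min h h')‖ := by
    intro n h h'
    refine (Complex.re_le_norm _).trans (le_of_eq ?_)
    rcases le_total h' h with hh | hh
    · simp only [hv]
      congr 3
      ext x
      rw [min_eq_right hh, show n + h' + (h - h' + (h' - h)) = n + h by omega]
    · simp only [hv]
      rw [min_eq_left hh, show n + h + (h - h' + (h' - h)) = n + h' by omega,
        ← Complex.norm_conj, ← integral_conj]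
      congr 3
      ext x
      simp [mul_comm]
  have hstep : ∫ x, ‖∑ n ∈ Finset.range N, F n x‖ ^ 2 ∂μ ≤
      2 * N / (H : ℝ) ^ 2 * (∑ n ∈ Finset.range N, ∑ h ∈ Finset.range H, ∑ h' ∈ Finset.range H,
        (∫ x, F (n + h) x * conj (F (n + h') x) ∂μ).re) + 8 * (H : ℝ) ^ 2 * B ^ 2 := by
    have hsq : ∀ n, Integrable (fun x => ‖∑ h ∈ Finset.range H, F (n + h) x‖ ^ 2) μ := fun n =>
      (BddBy.sum (Finset.range H) fun h _ => hF (n + h)).integrable_sq μ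
    have hexp : ∀ n, ∫ x, ‖∑ h ∈ Finset.range H, F (n + h) x‖ ^ 2 ∂μ =
        ∑ h ∈ Finset.range H, ∑ h' ∈ Finset.range H,
          (∫ x, F (n + h) x * conj (F (n + h') x) ∂μ).re := by
      intro n
      have e : ∀ x, ‖∑ h ∈ Finset.range H, F (n + h) x‖ ^ 2 =
          (∑ h ∈ Finset.range H, ∑ h' ∈ Finset.range H, F (n + h) x * conj (F (n + h') x)).re := by
        intro x
        rw [← Finset.sum_mul_sum, ← map_sum, Complex.mul_conj, Complex.ofReal_re,
          Complex.normSq_eq_norm_sq]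
      simp_rw [e]
      have := integral_re (μ := μ) (𝕜 := ℂ) (f := fun x => ∑ h ∈ Finset.range H,
        ∑ h' ∈ Finset.range H, F (n + h) x * conj (F (n + h') x))
        (integrable_finsetSum _ fun h _ => integrable_finsetSum _ fun h' _ => hii _ _)
      simp only [RCLike.re_eq_complex_re] at this
      rw [this, integral_finsetSum _ fun h _ => integrable_finsetSum _ fun h' _ => hii _ _,
        Complex.re_sum]
      refine Finset.sum_congr rfl fun h _ => ?_
      rw [integral_finsetSum _ fun h' _ => hii _ _, Complex.re_sum]
    calc _ ≤ ∫ x, (2 * N / (H : ℝ) ^ 2 * ∑ n ∈ Finset.range N,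
            ‖∑ h ∈ Finset.range H, F (n + h) x‖ ^ 2 + 8 * (H : ℝ) ^ 2 * B ^ 2) ∂μ := by
          refine integral_mono ((BddBy.sum (Finset.range N) fun n _ => hF n).integrable_sq μ)
            (((integrable_finsetSum _ fun n _ => hsq n).const_mul _).add (integrable_const _)) ?_
          intro x
          exact sq_norm_sum_le_sum_shift (fun n => (hF n).2 x) N hH
      _ = _ := by
          rw [integral_add ((integrable_finsetSum _ fun n _ => hsq n).const_mul _)
            (integrable_const _), integral_const_mul, integral_finsetSum _ fun n _ => hsq n]
          simp_rw [hexp]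
          simp
  have hsum : ∑ n ∈ Finset.range N, ∑ h ∈ Finset.range H, ∑ h' ∈ Finset.range H,
        (∫ x, F (n + h) x * conj (F (n + h') x) ∂μ).re ≤
      N * (2 * H * ∑ r ∈ Finset.range H, A r) + (H : ℝ) ^ 3 * B ^ 2 := by
    refine (Finset.sum_le_sum fun n _ => Finset.sum_le_sum fun h _ =>
      Finset.sum_le_sum fun h' _ => hpair n h h').trans ?_
    refine (sum_sum_sum_dist_le (fun r n => norm_nonneg (v r n)) hvB N H).trans (le_of_eq ?_)
    have h2 : ∑ r ∈ Finset.range H, ∑ n ∈ Finset.range N, ‖v r n‖ =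
        N * ∑ r ∈ Finset.range H, A r := by
      rw [Finset.mul_sum]
      refine Finset.sum_congr rfl fun r _ => ?_
      simp only [hA]
      rw [← mul_assoc, mul_one_div_cancel hN'.ne', one_mul]
    rw [h2]; ring
  have e0 : ∀ x, ‖(1 / (N : ℂ)) * ∑ n ∈ Finset.range N, F n x‖ ^ 2 =
      (1 / (N : ℝ) ^ 2) * ‖∑ n ∈ Finset.range N, F n x‖ ^ 2 := by
    intro x; rw [norm_mul, mul_pow]; simp
  simp_rw [e0]
  rw [integral_const_mul]
  calc _ ≤ (1 / (N : ℝ) ^ 2) * (2 * N / (H : ℝ) ^ 2 *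
        (N * (2 * H * ∑ r ∈ Finset.range H, A r) + (H : ℝ) ^ 3 * B ^ 2)
          + 8 * (H : ℝ) ^ 2 * B ^ 2) := by
        gcongr
        exact hstep.trans (by gcongr)
    _ = 4 / H * ∑ r ∈ Finset.range H, A r
        + (2 * H * B ^ 2 / N + 8 * (H : ℝ) ^ 2 * B ^ 2 / (N : ℝ) ^ 2) := by
        field_simp; ring

end

/-! ### Uniform bounds for averages of correlations -/

theorem exists_norm_le_one_mul_eq_norm (z : ℂ) : ∃ c : ℂ, ‖c‖ ≤ 1 ∧ c * z = ‖z‖ := by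
  rcases eq_or_ne z 0 with rfl | hz
  · exact ⟨0, by simp, by simp⟩
  · have hz' : (‖z‖ : ℂ) ≠ 0 := by exact_mod_cast norm_ne_zero_iff.2 hz
    refine ⟨conj z / ‖z‖, by simp [norm_ne_zero_iff.2 hz], ?_⟩
    rw [div_mul_eq_mul_div, Complex.conj_mul', sq, mul_div_cancel_right₀ _ hz']

section

variable {X : Type*} [MeasurableSpace X]

/-- If `‖G‖ ≤ 1`, averages of `‖∫ G F_n‖` are controlled by the self-correlations of `F`: insert
unimodular weights `c_n`, remove `G` by the Cauchy-Schwarz inequality and apply van der Corput's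
inequality to `c_n F_n`. The weights do not matter in the resulting bound. -/
theorem sq_avg_norm_integral_le (μ : Measure X) [IsProbabilityMeasure μ] {B : ℝ}
    {F : ℕ → X → ℂ} (hF : ∀ n, BddBy B (F n)) {G : X → ℂ} (hG : BddBy 1 G) {N H : ℕ}
    (hN : 0 < N) (hH : 0 < H) :
    ((1 / (N : ℝ)) * ∑ n ∈ Finset.range N, ‖∫ x, G x * F n x ∂μ‖) ^ 2 ≤
      4 / H * ∑ r ∈ Finset.range H,
          (1 / (N : ℝ)) * ∑ n ∈ Finset.range N, ‖∫ x, F (n + r) x * conj (F n x) ∂μ‖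
        + (2 * H * B ^ 2 / N + 8 * (H : ℝ) ^ 2 * B ^ 2 / (N : ℝ) ^ 2) := by
  choose c hc1 hc2 using exists_norm_le_one_mul_eq_norm
  set w : ℕ → ℂ := fun n => c (∫ x, G x * F n x ∂μ) with hw
  set F' : ℕ → X → ℂ := fun n x => w n * F n x with hF'
  have hF'b : ∀ n, BddBy B (F' n) := fun n => by
    simpa using (hF n).const_mul (hc1 (∫ x, G x * F n x ∂μ))
  set A : X → ℂ := fun x => (1 / (N : ℂ)) * ∑ n ∈ Finset.range N, F' n x with hA
  obtain ⟨D, hAb⟩ : ∃ D, BddBy D A :=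
    ⟨_, (BddBy.sum (Finset.range N) fun n _ => hF'b n).const_mul le_rfl⟩
  have hGF : ∀ n, Integrable (fun x => G x * F' n x) μ := fun n =>
    (hG.mul (hF'b n)).integrable μ
  have h1 : (((1 / (N : ℝ)) * ∑ n ∈ Finset.range N, ‖∫ x, G x * F n x ∂μ‖ : ℝ) : ℂ)
      = ∫ x, G x * A x ∂μ := by
    have e : ∀ x, G x * A x = (1 / (N : ℂ)) * ∑ n ∈ Finset.range N, G x * F' n x := by
      intro x; simp only [hA]; rw [← Finset.mul_sum]; ring
    simp_rw [e]
    rw [integral_const_mul, integral_finsetSum _ fun n _ => hGF n]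
    push_cast
    congr 1
    refine Finset.sum_congr rfl fun n _ => ?_
    rw [← hc2 (∫ x, G x * F n x ∂μ), ← integral_const_mul]
    congr 1; ext x; simp only [hF', hw]; ring
  have h2 : (1 / (N : ℝ)) * ∑ n ∈ Finset.range N, ‖∫ x, G x * F n x ∂μ‖ ≤ ∫ x, ‖A x‖ ∂μ := by
    have h3 : 0 ≤ (1 / (N : ℝ)) * ∑ n ∈ Finset.range N, ‖∫ x, G x * F n x ∂μ‖ := by positivity
    rw [← abs_of_nonneg h3, ← Real.norm_eq_abs, ← Complex.norm_real, h1]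
    refine (norm_integral_le_integral_norm _).trans ?_
    refine integral_mono ((hG.mul hAb).integrable μ).norm (hAb.integrable μ).norm fun x => ?_
    simp only [norm_mul]
    exact mul_le_of_le_one_left (norm_nonneg _) (hG.2 x)
  have h4 : ∀ n r, ‖∫ x, F' (n + r) x * conj (F' n x) ∂μ‖ ≤
      ‖∫ x, F (n + r) x * conj (F n x) ∂μ‖ := by
    intro n r
    have e : ∀ x, F' (n + r) x * conj (F' n x) =
        (w (n + r) * conj (w n)) * (F (n + r) x * conj (F n x)) := by
      intro x; simp only [hF', map_mul]; ring
    simp_rw [e]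
    rw [integral_const_mul, norm_mul, norm_mul, Complex.norm_conj]
    exact mul_le_of_le_one_left (norm_nonneg _) (mul_le_one₀ (hc1 _) (norm_nonneg _) (hc1 _))
  calc _ ≤ (∫ x, ‖A x‖ ∂μ) ^ 2 := by gcongr
    _ ≤ ∫ x, ‖A x‖ ^ 2 ∂μ := sq_integral_norm_le (hAb.integrable μ) (hAb.integrable_sq μ)
    _ ≤ _ := integral_sq_norm_sum_le μ hF'b hN hH
    _ ≤ _ := by
        gcongr with r _ n _
        exact h4 n r

/-- The limiting form of `sq_avg_norm_integral_le`, uniform in a parameter `γ`. -/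
theorem eventually_avg_le_of_vdc (μ : Measure X) [IsProbabilityMeasure μ] {Γ : Type*} {B δ : ℝ}
    (hδ : 0 ≤ δ) {F : ℕ → Γ → ℕ → X → ℂ} (hF : ∀ N γ n, BddBy B (F N γ n))
    {G : Γ → X → ℂ} (hG : ∀ γ, BddBy 1 (G γ)) (a : ℕ → ℝ)
    (ha : ∀ r, ∀ ε > 0, ∀ᶠ N : ℕ in atTop, ∀ γ, (1 / (N : ℝ)) * ∑ n ∈ Finset.range N,
      ‖∫ x, F N γ (n + r) x * conj (F N γ n x) ∂μ‖ ≤ a r + ε)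
    (hH : ∀ η > 0, ∃ H : ℕ, 0 < H ∧ 4 / (H : ℝ) * ∑ r ∈ Finset.range H, a r ≤ δ ^ 2 + η) :
    ∀ ε > 0, ∀ᶠ N : ℕ in atTop, ∀ γ, (1 / (N : ℝ)) * ∑ n ∈ Finset.range N,
      ‖∫ x, G γ x * F N γ n x ∂μ‖ ≤ δ + ε := by
  intro ε hε
  obtain ⟨H, hH0, hHa⟩ := hH (ε ^ 2 / 4) (by positivity)
  have hH0' : (0 : ℝ) < H := by exact_mod_cast hH0
  have h1 : ∀ᶠ N : ℕ in atTop, ∀ r ∈ Finset.range H, ∀ γ, (1 / (N : ℝ)) *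
      ∑ n ∈ Finset.range N, ‖∫ x, F N γ (n + r) x * conj (F N γ n x) ∂μ‖ ≤ a r + ε ^ 2 / 16 :=
    (Filter.eventually_all_finset _).2 fun r _ => ha r _ (by positivity)
  have h2 : Tendsto (fun N : ℕ => 2 * H * B ^ 2 / N + 8 * (H : ℝ) ^ 2 * B ^ 2 / (N : ℝ) ^ 2)
      atTop (𝓝 0) := by
    have t1 := tendsto_const_div_atTop_nhds_zero_nat (2 * H * B ^ 2)
    have t2 : Tendsto (fun N : ℕ => 8 * (H : ℝ) ^ 2 * B ^ 2 / (N : ℝ) ^ 2) atTop (𝓝 0) :=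
      Tendsto.const_div_atTop ((tendsto_pow_atTop two_ne_zero).comp
        tendsto_natCast_atTop_atTop) _
    simpa using t1.add t2
  filter_upwards [h1, h2.eventually_le_const (show (0 : ℝ) < ε ^ 2 / 4 by positivity),
    eventually_gt_atTop 0] with N hN1 hN2 hN γ
  refine abs_le_of_sq_le_sq' ?_ (by positivity) |>.2
  refine (sq_avg_norm_integral_le μ (hF N γ) (hG γ) hN hH0).trans ?_
  have h3 : 4 / (H : ℝ) * ∑ r ∈ Finset.range H, (1 / (N : ℝ)) *
      ∑ n ∈ Finset.range N, ‖∫ x, F N γ (n + r) x * conj (F N γ n x) ∂μ‖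
      ≤ 4 / (H : ℝ) * ∑ r ∈ Finset.range H, (a r + ε ^ 2 / 16) := by
    gcongr with r hr
    exact hN1 r hr γ
  rw [Finset.sum_add_distrib, mul_add] at h3
  have h4 : 4 / (H : ℝ) * ∑ r ∈ Finset.range H, ε ^ 2 / 16 = ε ^ 2 / 4 := by
    simp; field_simp; norm_num
  nlinarith [mul_nonneg hδ hε.le]

/-- The iterate `T ^ k`, `k ∈ ℤ`. -/
def intIterate (T : X ≃ᵐ X) (k : ℤ) : X → X := fun x => ((T.toEquiv : Equiv.Perm X) ^ k) x

theorem intIterate_add (T : X ≃ᵐ X) (a b : ℤ) (x : X) :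
    intIterate T (a + b) x = intIterate T a (intIterate T b x) := by
  simp [intIterate, zpow_add]

@[simp] theorem intIterate_zero (T : X ≃ᵐ X) (x : X) : intIterate T 0 x = x := by
  simp [intIterate]

theorem intIterate_natCast (T : X ≃ᵐ X) (n : ℕ) : intIterate T n = T^[n] := by
  ext x
  simp only [intIterate, zpow_natCast]
  rw [← Equiv.Perm.iterate_eq_pow]
  rfl

theorem measurePreserving_intIterate {μ : Measure X} {T : X ≃ᵐ X} (hT : MeasurePreserving T μ μ)
    (k : ℤ) : MeasurePreserving (intIterate T k) μ μ := by
  have key : ∀ n : ℕ, intIterate T (-(n : ℤ)) = T.symm^[n] := by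
    intro n
    ext x
    have : T^[n] (intIterate T (-(n : ℤ)) x) = x := by
      rw [← intIterate_natCast, ← intIterate_add]; simp
    conv_rhs => rw [← this]
    rw [Function.LeftInverse.iterate (fun y => T.symm_apply_apply y) n]
  obtain ⟨n, rfl | rfl⟩ := k.eq_nat_or_neg
  · rw [intIterate_natCast]; exact hT.iterate n
  · rw [key]; exact (hT.symm T).iterate n

theorem BddBy.comp_intIterate {μ : Measure X} {T : X ≃ᵐ X} (hT : MeasurePreserving T μ μ) {B : ℝ}
    {g : X → ℂ} (hg : BddBy B g) (k : ℤ) : BddBy B (fun x => g (intIterate T k x)) :=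
  hg.comp (measurePreserving_intIterate hT k).measurable

theorem BddBy.integral_comp_intIterate {μ : Measure X} {T : X ≃ᵐ X}
    (hT : MeasurePreserving T μ μ) {B : ℝ} {g : X → ℂ} (hg : BddBy B g) (k : ℤ) :
    ∫ x, g (intIterate T k x) ∂μ = ∫ x, g x ∂μ := by
  have h := measurePreserving_intIterate hT k
  conv_rhs => rw [← h.map_eq]
  rw [integral_map h.measurable.aemeasurable hg.1.aestronglyMeasurable]

/-- The averages over `n < N` of the correlations
`|∫ T^{e₀ N n} f · ∏ i, T^{e i N n} (g i) dμ|` are asymptotically at most `δ`, as `N → ∞`,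
uniformly in the measurable functions `g i` bounded by `1`. -/
def CorrLE {ι : Type*} [Fintype ι] (μ : Measure X) (T : X ≃ᵐ X) (f : X → ℂ) (e₀ : ℕ → ℕ → ℤ)
    (e : ι → ℕ → ℕ → ℤ) (δ : ℝ) : Prop :=
  ∀ ε > 0, ∀ᶠ N : ℕ in atTop, ∀ g : ι → X → ℂ, (∀ i, BddBy 1 (g i)) →
    (1 / (N : ℝ)) * ∑ n ∈ Finset.range N, ‖∫ x, f (intIterate T (e₀ N n) x) *
      ∏ i, g i (intIterate T (e i N n) x) ∂μ‖ ≤ δ + ε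

theorem bddBy_correlation {μ : Measure X} {T : X ≃ᵐ X} (hT : MeasurePreserving T μ μ)
    {ι : Type*} [Fintype ι] {B : ℝ} {f : X → ℂ} (hf : BddBy B f) {g : ι → X → ℂ}
    (hg : ∀ i, BddBy 1 (g i)) (a : ℤ) (b : ι → ℤ) :
    BddBy B (fun x => f (intIterate T a x) * ∏ i, g i (intIterate T (b i) x)) := by
  simpa using (hf.comp_intIterate hT a).mul
    (BddBy.prod Finset.univ fun i _ => (hg i).comp_intIterate hT (b i))

/-- Exponents may be changed by a common sequence `q` and by bounded errors, functions with the same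
exponent may be merged (along `φ`), and further exponents may be added. -/
theorem CorrLE.of_approx {μ : Measure X} {T : X ≃ᵐ X} (hT : MeasurePreserving T μ μ)
    {ι κ : Type*} [Fintype ι] [Fintype κ] {B : ℝ} {f : X → ℂ} (hf : BddBy B f)
    {e₀ e₀' : ℕ → ℕ → ℤ} {e : ι → ℕ → ℕ → ℤ} {e' : κ → ℕ → ℕ → ℤ} (φ : ι → κ) (q : ℕ → ℕ → ℤ)
    (C : ℤ) (h₀ : ∀ᶠ N in atTop, ∀ n, |e₀ N n - e₀' N n - q N n| ≤ C)
    (h : ∀ i, ∀ᶠ N in atTop, ∀ n, |e i N n - e' (φ i) N n - q N n| ≤ C)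
    (H : CorrLE μ T f e₀' e' 0) : CorrLE μ T f e₀ e 0 := by
  classical
  intro ε hε
  -- after a translation by the error of `e₀`, the other errors lie in `[-2 C, 2 C]`
  set W : Finset (ι → ℤ) := Fintype.piFinset fun _ => Finset.Icc (-(2 * C)) (2 * C) with hW
  have hWpos : (0 : ℝ) < W.card + 1 := by positivity
  filter_upwards [H (ε / (W.card + 1)) (by positivity), h₀, eventually_all.2 h] with N hN hN0 hN1 g hg
  -- the functions obtained for the vector `w` of errors
  set g' : (ι → ℤ) → κ → X → ℂ := fun w k x =>
    ∏ i ∈ Finset.univ.filter (fun i => φ i = k), g i (intIterate T (w i) x) with hg'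
  have hg'b : ∀ w k, BddBy 1 (g' w k) := fun w k =>
    BddBy.prod _ fun i _ => (hg i).comp_intIterate hT _
  set I : (ι → ℤ) → ℕ → ℝ := fun w n => ‖∫ x, f (intIterate T (e₀' N n) x) *
      ∏ k, g' w k (intIterate T (e' k N n) x) ∂μ‖ with hI
  have key : ∀ n, ‖∫ x, f (intIterate T (e₀ N n) x) *
      ∏ i, g i (intIterate T (e i N n) x) ∂μ‖ ≤ ∑ w ∈ W, I w n := by
    intro n
    set v₀ := e₀ N n - e₀' N n - q N n with hv₀
    set w : ι → ℤ := fun i => (e i N n - e' (φ i) N n - q N n) - v₀ with hw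
    have hwW : w ∈ W := by
      refine Fintype.mem_piFinset.2 fun i => Finset.mem_Icc.2 ?_
      have h1 := abs_le.1 (hN0 n)
      have h2 := abs_le.1 (hN1 i n)
      simp only [hw]
      constructor <;> linarith [h1.1, h1.2, h2.1, h2.2]
    have e1 : ∫ x, f (intIterate T (e₀ N n) x) * ∏ i, g i (intIterate T (e i N n) x) ∂μ =
        ∫ x, f (intIterate T (e₀' N n) x) * ∏ k, g' w k (intIterate T (e' k N n) x) ∂μ := by
      rw [← (bddBy_correlation hT hf (hg'b w) (e₀' N n) (fun k => e' k N n)).integral_comp_intIterate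
        hT (q N n + v₀)]
      congr 1
      ext x
      rw [← intIterate_add, show e₀' N n + (q N n + v₀) = e₀ N n by simp only [hv₀]; ring]
      congr 1
      simp only [hg']
      rw [← Finset.prod_fiberwise (s := Finset.univ) (g := φ)]
      refine Finset.prod_congr rfl fun k _ => Finset.prod_congr rfl fun i hi => ?_
      have hik : φ i = k := by simpa using hi
      rw [← intIterate_add, ← intIterate_add]
      congr 2
      simp only [hw, ← hik]; ring
    rw [e1]
    exact Finset.single_le_sum (f := fun w => I w n) (fun _ _ => norm_nonneg _) hwW
  calc _ ≤ (1 / (N : ℝ)) * ∑ n ∈ Finset.range N, ∑ w ∈ W, I w n := by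
        gcongr with n _; exact key n
    _ = ∑ w ∈ W, (1 / (N : ℝ)) * ∑ n ∈ Finset.range N, I w n := by
        rw [Finset.sum_comm, Finset.mul_sum]
    _ ≤ ∑ w ∈ W, ε / (W.card + 1) := by
        gcongr with w _
        simpa using hN (g' w) (hg'b w)
    _ ≤ 0 + ε := by
        rw [Finset.sum_const, nsmul_eq_mul, zero_add, mul_div_assoc', div_le_iff₀ hWpos]
        nlinarith

/-- The exponents after a van der Corput operation with shift `r`, in a family which contained the
target exponent `e₀`, the exponents `e i` and the exponent `0`: the exponent `0` disappears, the new
target is `e₀ (n + r)`, and the other exponents are the ones listed here. -/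
def vdcExponents {ι : Type*} (e₀ : ℕ → ℕ → ℤ) (e : ι → ℕ → ℕ → ℤ) (r : ℕ) :
    Option ι ⊕ ι → ℕ → ℕ → ℤ :=
  Sum.elim (fun o => o.elim e₀ e) (fun i N n => e i N (n + r))

/-- One van der Corput operation: the function with exponent `0` is removed. Bounds are needed for
large shifts only, as the shifts `r < r₀` are negligible in the average over `r < H`. -/
theorem CorrLE.of_vdcExponents {μ : Measure X} [IsProbabilityMeasure μ] {T : X ≃ᵐ X}
    (hT : MeasurePreserving T μ μ) {ι : Type*} [Fintype ι] {f : X → ℂ} (hf : BddBy 1 f)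
    {e₀ : ℕ → ℕ → ℤ} {e : ι → ℕ → ℕ → ℤ} (r₀ : ℕ)
    (H : ∀ r, r₀ ≤ r → CorrLE μ T f (fun N n => e₀ N (n + r)) (vdcExponents e₀ e r) 0) :
    CorrLE μ T f e₀ (fun o : Option ι => o.elim (fun _ _ => 0) e) 0 := by
  set F : ℕ → {g : Option ι → X → ℂ // ∀ i, BddBy 1 (g i)} → ℕ → X → ℂ := fun N g n x =>
    f (intIterate T (e₀ N n) x) * ∏ i, g.1 (some i) (intIterate T (e i N n) x) with hF
  have hFb : ∀ N g n, BddBy 1 (F N g n) := fun N g n =>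
    bddBy_correlation hT hf (fun i => g.2 (some i)) _ (fun i => e i N n)
  have := eventually_avg_le_of_vdc μ (le_refl (0 : ℝ)) hFb
    (G := fun g => g.1 none) (fun g => g.2 none) (fun r => if r < r₀ then 1 else 0) ?_ ?_
  · intro ε hε
    filter_upwards [this ε hε] with N hN g hg
    refine le_of_eq_of_le ?_ (hN ⟨g, hg⟩)
    congr 1
    refine Finset.sum_congr rfl fun n _ => ?_
    congr 2
    ext x
    simp only [hF, Fintype.prod_option, Option.elim, intIterate_zero]
    ring
  · intro r ε hε
    split_ifs with hr
    · filter_upwards [eventually_gt_atTop 0] with N hN g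
      have hN' : (0 : ℝ) < N := by exact_mod_cast hN
      calc _ ≤ (1 / (N : ℝ)) * ∑ n ∈ Finset.range N, (1 : ℝ) := by
            gcongr with n _
            exact ((hFb N g (n + r)).one_mul_one (hFb N g n).conj).norm_integral_le μ
        _ = 1 := by simp; field_simp
        _ ≤ 1 + ε := by linarith
    · filter_upwards [H r (not_lt.1 hr) ε hε] with N hN g
      have hb : ∀ y : Option ι ⊕ ι, BddBy 1 ((Sum.elim
          (fun o : Option ι => o.elim (fun x => conj (f x)) (fun i x => conj (g.1 (some i) x)))
          (fun i => g.1 (some i)) : Option ι ⊕ ι → X → ℂ) y) := by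
        rintro ((_ | i) | i)
        · exact hf.conj
        · exact (g.2 (some i)).conj
        · exact g.2 (some i)
      refine le_of_eq_of_le ?_ (hN _ hb)
      congr 1
      refine Finset.sum_congr rfl fun n _ => ?_
      congr 2
      ext x
      simp only [hF, vdcExponents, Fintype.prod_sum_type, Fintype.prod_option, Sum.elim_inl,
        Sum.elim_inr, Option.elim, map_mul, map_prod]
      ring
  · intro η hη
    obtain ⟨H, hH⟩ := exists_nat_gt (4 * r₀ / η)
    have hH0 : (0 : ℝ) < H := lt_of_le_of_lt (by positivity) hH
    refine ⟨H, by exact_mod_cast hH0, ?_⟩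
    have h1 : ∑ r ∈ Finset.range H, (if r < r₀ then (1 : ℝ) else 0) ≤ r₀ := by
      rw [← Finset.sum_filter]
      simp only [Finset.sum_const, nsmul_eq_mul, mul_one, Nat.cast_le]
      refine (Finset.card_le_card (t := Finset.range r₀) fun x hx => ?_).trans (by simp)
      simpa using (Finset.mem_filter.1 hx).2
    calc _ ≤ 4 / (H : ℝ) * r₀ := by gcongr
      _ ≤ _ := by
        rw [div_lt_iff₀ hη] at hH
        rw [div_mul_eq_mul_div, div_le_iff₀ hH0]
        nlinarith

end

/-! ### Linear exponents -/

theorem card_le_of_forall_sub_le {s : Finset ℕ} {x : ℝ} (hx : 0 ≤ x)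
    (h : ∀ a ∈ s, ∀ b ∈ s, (a : ℝ) - b ≤ x) : (s.card : ℝ) ≤ x + 1 := by
  rcases s.eq_empty_or_nonempty with rfl | hs
  · simp; linarith
  · have h1 : s ⊆ Finset.Icc (s.min' hs) (s.min' hs + ⌊x⌋₊) := by
      intro a ha
      refine Finset.mem_Icc.2 ⟨s.min'_le a ha, ?_⟩
      have h2 := h a ha _ (s.min'_mem hs)
      have h3 : s.min' hs ≤ a := s.min'_le a ha
      have h4 : a - s.min' hs ≤ ⌊x⌋₊ := Nat.le_floor (by push_cast [h3]; exact h2)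
      omega
    have h5 := Finset.card_le_card h1
    rw [Nat.card_Icc] at h5
    have h6 : (s.card : ℝ) ≤ (⌊x⌋₊ + 1 : ℕ) := by
      exact_mod_cast h5.trans (by omega)
    refine h6.trans ?_
    push_cast
    linarith [Nat.floor_le hx]

section

variable {X : Type*} [MeasurableSpace X]

/-- Change of variables: if `u N n = α N * n + β N + O(1)`, where `α N` is bounded, then `u N` takes
each value `O(1 / |α N|)` times on `n < N`, and the values lie in an interval of length
`|α N| * N + O(1)`. So averages of nonnegative quantities along `u N` are bounded by averages along
the integers of such an interval. -/
theorem CorrLE.of_linear {μ : Measure X} {T : X ≃ᵐ X} (hT : MeasurePreserving T μ μ)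
    {ι : Type*} [Fintype ι] {B : ℝ} {f : X → ℂ} (hf : BddBy B f) {M₀ : ℤ} {M : ι → ℤ}
    (H : CorrLE μ T f (fun _ n => M₀ * n) (fun i _ n => M i * n) 0)
    {u : ℕ → ℕ → ℤ} {α β : ℕ → ℝ} {A C : ℝ} (hA : ∀ᶠ N in atTop, |α N| ≤ A)
    (hα : Tendsto (fun N : ℕ => |α N| * N) atTop atTop)
    (hu : ∀ᶠ N in atTop, ∀ n : ℕ, |(u N n : ℝ) - α N * n - β N| ≤ C) :
    CorrLE μ T f (fun N n => M₀ * u N n) (fun i N n => M i * u N n) 0 := by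
  intro ε hε
  obtain ⟨N₁, hN₁⟩ := (hA.and hu).exists
  have hA0 : 0 ≤ A := (abs_nonneg _).trans hN₁.1
  have hC0 : 0 ≤ C := (abs_nonneg _).trans (hN₁.2 0)
  set K := (2 * C + A) * (2 * C + 4) with hK
  have hK0 : 0 ≤ K := by positivity
  obtain ⟨J₀, hJ₀⟩ := eventually_atTop.1 (H (ε / (K + 1)) (by positivity))
  filter_upwards [hA, hu, hα.eventually_ge_atTop (max J₀ 1), eventually_gt_atTop 0]
    with N hAN huN hαN hN g hg
  have hN' : (0 : ℝ) < N := by exact_mod_cast hN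
  set a := |α N| with ha
  have haN1 : 1 ≤ a * N := (le_max_right _ _).trans hαN
  have ha0 : 0 < a := pos_of_mul_pos_left (by linarith) hN'.le
  set J : ℕ := ⌈a * N + 2 * C⌉₊ + 1 with hJ
  have hJge : a * N + 2 * C + 1 ≤ J := by
    rw [hJ]; push_cast; linarith [Nat.le_ceil (a * N + 2 * C)]
  have hJle : (J : ℝ) ≤ a * N + 2 * C + 2 := by
    rw [hJ]; push_cast; linarith [Nat.ceil_lt_add_one (show 0 ≤ a * N + 2 * C by positivity)]
  have hJJ₀ : J₀ ≤ J := by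
    have : (J₀ : ℝ) ≤ J := by linarith [(le_max_left (J₀ : ℝ) 1).trans hαN]
    exact_mod_cast this
  -- the values of `u N` on `n < N` lie in `[m, m + J)`
  set m : ℤ := ⌊min (β N) (β N + α N * N) - C⌋ with hm
  have hrange : ∀ n ∈ Finset.range N, ∃ j ∈ Finset.range J, u N n = m + (j : ℤ) := by
    intro n hn
    have hnN : (n : ℝ) ≤ N := by exact_mod_cast (Finset.mem_range.1 hn).le
    have hn0 : (0 : ℝ) ≤ n := by positivity
    have h1 := abs_le.1 (huN n)
    have hmin : min (β N) (β N + α N * N) ≤ α N * n + β N ∧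
        α N * n + β N ≤ min (β N) (β N + α N * N) + a * N := by
      rcases le_total 0 (α N) with h | h
      · rw [ha, abs_of_nonneg h, min_eq_left (by nlinarith)]; constructor <;> nlinarith
      · rw [ha, abs_of_nonpos h, min_eq_right (by nlinarith)]; constructor <;> nlinarith
    have hm1 : (m : ℝ) ≤ min (β N) (β N + α N * N) - C := Int.floor_le _
    have hm2 : min (β N) (β N + α N * N) - C < m + 1 := Int.lt_floor_add_one _
    have h2 : m ≤ u N n := by
      have : (m : ℝ) ≤ u N n := by linarith [h1.1]
      exact_mod_cast this
    have h3 : u N n < m + J := by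
      have : (u N n : ℝ) < m + J := by linarith [h1.2]
      exact_mod_cast this
    refine ⟨(u N n - m).toNat, Finset.mem_range.2 (by omega), by omega⟩
  set I : ℤ → ℝ := fun k => ‖∫ x, f (intIterate T (M₀ * k) x) *
      ∏ i, g i (intIterate T (M i * k) x) ∂μ‖ with hI
  -- each value is taken at most `D` times
  set D := 2 * C / a + 1 with hD
  have hcount : ∀ k : ℤ, (((Finset.range N).filter fun n => u N n = k).card : ℝ) ≤ D := by
    intro k
    refine card_le_of_forall_sub_le (by positivity) fun n hn n' hn' => ?_
    have h1 := huN n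
    have h2 := huN n'
    rw [(Finset.mem_filter.1 hn).2] at h1
    rw [(Finset.mem_filter.1 hn').2] at h2
    have h3 : |α N * ((n : ℝ) - n')| ≤ 2 * C := by
      calc _ = |((k : ℝ) - α N * n' - β N) - ((k : ℝ) - α N * n - β N)| := by congr 1; ring
        _ ≤ _ := (abs_sub _ _).trans (by linarith)
    rw [abs_mul] at h3
    rw [le_div_iff₀ ha0]
    nlinarith [le_abs_self ((n : ℝ) - n')]
  have hsum : ∑ n ∈ Finset.range N, I (u N n) ≤ ∑ j ∈ Finset.range J, D * I (m + j) := by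
    have hinj : ∀ j ∈ Finset.range J, ∀ j' ∈ Finset.range J, (m + (j : ℤ)) = m + j' → j = j' := by
      intro j _ j' _ h; omega
    have hmaps : ∀ n ∈ Finset.range N,
        u N n ∈ (Finset.range J).image (fun j : ℕ => m + (j : ℤ)) := by
      intro n hn
      obtain ⟨j, hj, h⟩ := hrange n hn
      exact Finset.mem_image.2 ⟨j, hj, h.symm⟩
    rw [← Finset.sum_fiberwise_of_maps_to hmaps, Finset.sum_image hinj]
    refine Finset.sum_le_sum fun j _ => ?_
    rw [Finset.sum_congr rfl (g := fun _ => I (m + j)) fun n hn => by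
      rw [(Finset.mem_filter.1 hn).2], Finset.sum_const, nsmul_eq_mul]
    exact mul_le_mul_of_nonneg_right (hcount _) (norm_nonneg _)
  -- the translation by `m` is absorbed by the functions `g i`, by uniformity
  have hshift : (1 / (J : ℝ)) * ∑ j ∈ Finset.range J, I (m + j) ≤ ε / (K + 1) := by
    refine le_of_eq_of_le ?_ ((hJ₀ J hJJ₀ (fun i x => g i (intIterate T ((M i - M₀) * m) x))
      fun i => (hg i).comp_intIterate hT _).trans (by rw [zero_add]))
    congr 1
    refine Finset.sum_congr rfl fun j _ => ?_
    simp only [hI]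
    congr 1
    rw [← (bddBy_correlation hT hf (fun i => (hg i).comp_intIterate hT ((M i - M₀) * m))
      (M₀ * j) (fun i => M i * j)).integral_comp_intIterate hT (M₀ * m)]
    congr 1
    ext x
    rw [← intIterate_add, show M₀ * (j : ℤ) + M₀ * m = M₀ * (m + j) by ring]
    congr 1
    refine Finset.prod_congr rfl fun i _ => ?_
    rw [← intIterate_add, ← intIterate_add]
    congr 2; ring
  have hJ0 : (0 : ℝ) < J := by linarith
  calc (1 / (N : ℝ)) * ∑ n ∈ Finset.range N, I (u N n)
      ≤ (1 / (N : ℝ)) * ∑ j ∈ Finset.range J, D * I (m + j) := by gcongr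
    _ = D * J / N * ((1 / (J : ℝ)) * ∑ j ∈ Finset.range J, I (m + j)) := by
        rw [← Finset.mul_sum]; field_simp
    _ ≤ D * J / N * (ε / (K + 1)) := by gcongr
    _ ≤ K * (ε / (K + 1)) := by
        refine mul_le_mul_of_nonneg_right ?_ (by positivity)
        rw [div_le_iff₀ hN']
        have h1 : D = (2 * C + a) / a := by rw [hD]; field_simp
        rw [h1, div_mul_eq_mul_div, div_le_iff₀ ha0]
        have h2 : (J : ℝ) ≤ (2 * C + 4) * (a * N) := by nlinarith
        calc (2 * C + a) * J ≤ (2 * C + A) * ((2 * C + 4) * (a * N)) := by gcongr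
          _ = K * N * a := by rw [hK]; ring
    _ ≤ 0 + ε := by
        rw [zero_add, mul_div_assoc', div_le_iff₀ (by positivity)]
        nlinarith

end

/-! ### Elementary properties of the Host-Kra seminorms -/

section

variable {X : Type*} [MeasurableSpace X]

theorem hkSeminorm_congr_ae {μ : Measure X} {T : X → X} (hT : MeasurePreserving T μ μ) (k : ℕ) :
    ∀ {f f' : X → ℂ}, f =ᵐ[μ] f' → hkSeminorm μ T k f = hkSeminorm μ T k f' := by
  induction k with
  | zero => intro f f' _; simp [hkSeminorm]
  | succ k ih =>
    intro f f' h
    cases k with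
    | zero =>
      simp only [hkSeminorm]
      congr 1
      refine integral_congr_ae ?_
      filter_upwards [condExp_congr_ae (m := MeasurableSpace.invariants T) h] with x hx
      rw [hx]
    | succ k =>
      simp only [hkSeminorm]
      congr 3
      ext N
      congr 1
      refine Finset.sum_congr rfl fun n _ => ?_
      congr 1
      refine ih ?_
      filter_upwards [h, (hT.iterate n).quasiMeasurePreserving.ae_eq_comp h] with x hx hx'
      simp only [Function.comp] at hx'
      rw [hx, hx']

theorem norm_integral_le_hkSeminorm_one {μ : Measure X} [IsProbabilityMeasure μ] (T : X → X)
    {B : ℝ} {f : X → ℂ} (hf : BddBy B f) :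
    ‖∫ x, f x ∂μ‖ ≤ hkSeminorm μ T 1 f ∧ hkSeminorm μ T 1 f ≤ B := by
  have hB : 0 ≤ B := by
    obtain ⟨x⟩ := nonempty_of_isProbabilityMeasure μ
    exact (norm_nonneg _).trans (hf.2 x)
  set E := μ[f | MeasurableSpace.invariants T] with hE
  have hm := MeasurableSpace.invariants_le T
  have hEB : ∀ᵐ x ∂μ, ‖E x‖ ≤ B := by
    have h1 : μ[fun x => ‖f x‖ | MeasurableSpace.invariants T] ≤ᵐ[μ]
        μ[fun _ => B | MeasurableSpace.invariants T] :=
      condExp_mono (hf.integrable μ).norm (integrable_const _) (ae_of_all _ hf.2)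
    rw [condExp_const hm] at h1
    filter_upwards [h1, norm_condExp_le (μ := μ) (m := MeasurableSpace.invariants T) f]
      with x hx1 hx2
    exact hx2.trans hx1
  have hEm : AEStronglyMeasurable E μ := integrable_condExp.aestronglyMeasurable
  have hE2 : Integrable (fun x => ‖E x‖ ^ 2) μ := by
    refine .of_bound (hEm.norm.pow 2) (B ^ 2) ?_
    filter_upwards [hEB] with x hx
    rw [Real.norm_of_nonneg (by positivity)]
    gcongr
  simp only [hkSeminorm]
  constructor
  · refine Real.le_sqrt_of_sq_le ?_
    rw [← integral_condExp hm]
    refine le_trans ?_ (sq_integral_norm_le integrable_condExp hE2)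
    gcongr
    exact norm_integral_le_integral_norm _
  · refine (Real.sqrt_le_left hB).2 ?_
    calc ∫ x, ‖E x‖ ^ 2 ∂μ ≤ ∫ _, B ^ 2 ∂μ := by
          refine integral_mono_ae hE2 (integrable_const _) ?_
          filter_upwards [hEB] with x hx
          gcongr
      _ = B ^ 2 := by simp

theorem BddBy.conj_mul_iterate {μ : Measure X} {T : X ≃ᵐ X} (hT : MeasurePreserving T μ μ) {B : ℝ}
    {f : X → ℂ} (hf : BddBy B f) (n : ℕ) : BddBy (B ^ 2) (fun x => conj (f x) * f (T^[n] x)) := by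
  rw [sq]
  exact hf.conj.mul (hf.comp (hT.iterate n).measurable)

theorem avg_Icc_le {a : ℕ → ℝ} {b : ℝ} (hb : 0 ≤ b) (ha : ∀ n, a n ≤ b) (N : ℕ) :
    (1 / (N : ℝ)) * ∑ n ∈ Finset.Icc 1 N, a n ≤ b := by
  rcases N.eq_zero_or_pos with rfl | hN
  · simpa using hb
  · have hN' : (0 : ℝ) < N := by exact_mod_cast hN
    calc _ ≤ (1 / (N : ℝ)) * ∑ n ∈ Finset.Icc 1 N, b := by gcongr with n _; exact ha n
      _ = b := by simp; field_simp

theorem avg_Icc_nonneg {a : ℕ → ℝ} (ha : ∀ n, 0 ≤ a n) (N : ℕ) :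
    0 ≤ (1 / (N : ℝ)) * ∑ n ∈ Finset.Icc 1 N, a n :=
  mul_nonneg (by positivity) (Finset.sum_nonneg fun n _ => ha n)

theorem limsup_avg_mem_Icc {a : ℕ → ℝ} {b : ℝ} (h0 : ∀ n, 0 ≤ a n) (ha : ∀ n, a n ≤ b) :
    limsup (fun N : ℕ => (1 / (N : ℝ)) * ∑ n ∈ Finset.Icc 1 N, a n) atTop ∈ Set.Icc 0 b := by
  have hb : 0 ≤ b := (h0 0).trans (ha 0)
  constructor
  · refine le_limsup_of_frequently_le (Eventually.of_forall fun N => avg_Icc_nonneg h0 N).frequently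
      ?_
    exact isBoundedUnder_of ⟨b, avg_Icc_le hb ha⟩
  · refine limsup_le_of_le ?_ (Eventually.of_forall fun N => avg_Icc_le hb ha N)
    exact (isBoundedUnder_of ⟨0, avg_Icc_nonneg h0⟩ : IsBoundedUnder (· ≥ ·) _ _).isCoboundedUnder_le

theorem hkSeminorm_mem_Icc {μ : Measure X} [IsProbabilityMeasure μ] {T : X ≃ᵐ X}
    (hT : MeasurePreserving T μ μ) (k : ℕ) :
    ∀ {B : ℝ} {f : X → ℂ}, BddBy B f → hkSeminorm μ T (k + 1) f ∈ Set.Icc 0 B := by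
  induction k with
  | zero =>
    intro B f hf
    have := norm_integral_le_hkSeminorm_one (μ := μ) T hf
    exact ⟨(norm_nonneg _).trans this.1, this.2⟩
  | succ k ih =>
    intro B f hf
    have hB : 0 ≤ B := by
      obtain ⟨x⟩ := nonempty_of_isProbabilityMeasure μ
      exact (norm_nonneg _).trans (hf.2 x)
    have h1 := fun n => ih (hf.conj_mul_iterate hT n)
    have h2 := limsup_avg_mem_Icc (b := B ^ 2 ^ (k + 2))
      (a := fun n => hkSeminorm μ T (k + 1) (fun x => conj (f x) * f (T^[n] x)) ^ 2 ^ (k + 1))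
      (fun n => pow_nonneg (h1 n).1 _) (fun n => by
        have := pow_le_pow_left₀ (h1 n).1 (h1 n).2 (2 ^ (k + 1))
        rwa [← pow_mul, ← pow_succ' 2 (k + 1)] at this)
    simp only [hkSeminorm]
    refine ⟨Real.rpow_nonneg h2.1 _, ?_⟩
    refine (Real.rpow_le_rpow h2.1 h2.2 (by positivity)).trans (le_of_eq ?_)
    rw [← Real.rpow_natCast B, ← Real.rpow_mul hB]
    push_cast
    rw [mul_one_div_cancel (by positivity), Real.rpow_one]

end

/-! ### Linear exponents and Host-Kra seminorms -/

/-- Averages of `a` along the multiples of `d` are controlled by the upper averages of `a ^ p`. -/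
theorem exists_sum_mul_le_limsup {a : ℕ → ℝ} {b : ℝ} (h0 : ∀ n, 0 ≤ a n) (ha : ∀ n, a n ≤ b)
    {p d : ℕ} (hp : 0 < p) (hd : 0 < d) {K : ℝ} (hK : 0 ≤ K) {η : ℝ} (hη : 0 < η) :
    ∃ H : ℕ, 0 < H ∧ K / (H : ℝ) * ∑ r ∈ Finset.range H, a (d * r) ≤
      K * d * (limsup (fun N : ℕ => (1 / (N : ℝ)) * ∑ n ∈ Finset.Icc 1 N, a n ^ p) atTop)
        ^ ((1 : ℝ) / p) + η := by
  set S : ℕ → ℝ := fun N => (1 / (N : ℝ)) * ∑ n ∈ Finset.Icc 1 N, a n ^ p with hS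
  set L := limsup S atTop with hL
  have hb : 0 ≤ b := (h0 0).trans (ha 0)
  have hpow0 : ∀ n, 0 ≤ a n ^ p := fun n => pow_nonneg (h0 n) p
  have hpowb : ∀ n, a n ^ p ≤ b ^ p := fun n => pow_le_pow_left₀ (h0 n) (ha n) p
  have hL0 : 0 ≤ L := (limsup_avg_mem_Icc hpow0 hpowb).1
  have hp' : (0 : ℝ) < p := by exact_mod_cast hp
  have hd' : (0 : ℝ) < d := by exact_mod_cast hd
  have hcont : Tendsto (fun y : ℝ => K * d * y ^ ((1 : ℝ) / p)) (𝓝[>] L)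
      (𝓝 (K * d * L ^ ((1 : ℝ) / p))) :=
    (((Real.continuousAt_rpow_const _ _ (Or.inr (by positivity))).const_mul _).tendsto).mono_left
      nhdsWithin_le_nhds
  obtain ⟨y, hyη, hyL⟩ := ((hcont.eventually_lt_const
    (show K * d * L ^ ((1 : ℝ) / p) < K * d * L ^ ((1 : ℝ) / p) + η / 2 by linarith)).and
      self_mem_nhdsWithin).exists
  have hev : ∀ᶠ N in atTop, S N < y := eventually_lt_of_limsup_lt hyL
    (isBoundedUnder_of ⟨b ^ p, avg_Icc_le (pow_nonneg hb p) hpowb⟩)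
  have hev' : ∀ᶠ H : ℕ in atTop, S (d * H) < y :=
    (tendsto_id.const_mul_atTop' hd).eventually hev
  have hsmall := (tendsto_const_div_atTop_nhds_zero_nat (K * a 0)).eventually_le_const
    (show (0 : ℝ) < η / 2 by positivity)
  obtain ⟨H, hH1, hH2, hH0⟩ := (hev'.and (hsmall.and (eventually_gt_atTop 0))).exists
  have hH0' : (0 : ℝ) < H := by exact_mod_cast hH0
  refine ⟨H, hH0, ?_⟩
  have hsum : ∑ r ∈ Finset.range H, a (d * r) ≤ a 0 + ∑ n ∈ Finset.Icc 1 (d * H), a n := by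
    have h1 : ∑ r ∈ Finset.range H, a (d * r) ≤ ∑ n ∈ Finset.range (d * H + 1), a n := by
      rw [← Finset.sum_image (f := a) (g := fun r => d * r)
        fun x _ y _ h => Nat.eq_of_mul_eq_mul_left hd h]
      refine Finset.sum_le_sum_of_subset_of_nonneg ?_ fun _ _ _ => h0 _
      intro z hz
      obtain ⟨r, hr, rfl⟩ := Finset.mem_image.1 hz
      exact Finset.mem_range.2 (Nat.lt_succ_of_le
        (Nat.mul_le_mul_left d (Finset.mem_range.1 hr).le))
    refine h1.trans (le_of_eq ?_)
    rw [Finset.sum_range_succ', add_comm, Finset.range_eq_Ico, Finset.sum_Ico_add' a 0 (d * H) 1]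
    rfl
  have hmean : (1 / ((d * H : ℕ) : ℝ)) * ∑ n ∈ Finset.Icc 1 (d * H), a n ≤ y ^ ((1 : ℝ) / p) := by
    have hdH : (0 : ℝ) < ((d * H : ℕ) : ℝ) := by exact_mod_cast Nat.mul_pos hd hH0
    have h2 := Real.pow_arith_mean_le_arith_mean_pow (Finset.Icc 1 (d * H))
      (fun _ => 1 / ((d * H : ℕ) : ℝ)) a (fun _ _ => by positivity)
      (by simp only [Finset.sum_const, Nat.card_Icc, nsmul_eq_mul, Nat.add_sub_cancel]
          exact mul_one_div_cancel hdH.ne') (fun n _ => h0 n) p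
    rw [← Finset.mul_sum, ← Finset.mul_sum] at h2
    have h3 := avg_Icc_nonneg h0 (d * H)
    rw [one_div (p : ℝ)]
    refine (Real.le_rpow_inv_iff_of_pos h3 (hL0.trans hyL.le) hp').2 ?_
    rw [Real.rpow_natCast]
    exact h2.trans hH1.le
  calc K / (H : ℝ) * ∑ r ∈ Finset.range H, a (d * r)
      ≤ K / (H : ℝ) * (a 0 + ∑ n ∈ Finset.Icc 1 (d * H), a n) := by gcongr
    _ = K * d * ((1 / ((d * H : ℕ) : ℝ)) * ∑ n ∈ Finset.Icc 1 (d * H), a n) + K * a 0 / H := by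
        push_cast; field_simp; ring
    _ ≤ K * d * y ^ ((1 : ℝ) / p) + η / 2 := by gcongr
    _ ≤ _ := by linarith

section

variable {X : Type*} [MeasurableSpace X]

/-- The self-correlations of `n ↦ T^{D n} f · ∏ i, T^{M i n} (g i)` are correlations of the same kind,
of the function `conj f · T^{|D| r} f` with functions bounded by `1`. -/
theorem exists_norm_integral_eq {μ : Measure X} {T : X ≃ᵐ X} (hT : MeasurePreserving T μ μ)
    {ι : Type*} [Fintype ι] {B : ℝ} {f : X → ℂ} (hf : BddBy B f) {g : ι → X → ℂ}
    (hg : ∀ i, BddBy 1 (g i)) (D : ℤ) (M : ι → ℤ) (r : ℕ) :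
    ∃ g' : ι → X → ℂ, (∀ i, BddBy 1 (g' i)) ∧ ∀ n : ℕ,
      ‖∫ x, (f (intIterate T (D * (n + r : ℕ)) x) *
            ∏ i, g i (intIterate T (M i * (n + r : ℕ)) x)) *
          conj (f (intIterate T (D * n) x) * ∏ i, g i (intIterate T (M i * n) x)) ∂μ‖ =
        ‖∫ x, (fun y => conj (f y) * f (T^[D.natAbs * r] y)) (intIterate T (D * n) x) *
          ∏ i, g' i (intIterate T (M i * n) x) ∂μ‖ := by
  -- if `D ≤ 0`, the roles of `n` and `n + r` are exchanged by a translation and a conjugation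
  rcases le_total 0 D with hD | hD
  · refine ⟨fun i x => g i (intIterate T (M i * r) x) * conj (g i x),
      fun i => ((hg i).comp_intIterate hT _).one_mul_one (hg i).conj, fun n => ?_⟩
    congr 2
    ext x
    simp only [← intIterate_natCast, ← intIterate_add, map_mul, map_prod, Finset.prod_mul_distrib]
    have e1 : ((D.natAbs * r : ℕ) : ℤ) + D * n = D * (n + r : ℕ) := by
      push_cast; rw [abs_of_nonneg hD]; ring
    have e2 : ∀ i, M i * (r : ℤ) + M i * n = M i * (n + r : ℕ) := fun i => by push_cast; ring
    simp only [e1, e2]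
    ring
  · refine ⟨fun i x => conj (g i (intIterate T ((M i - D) * r) x)) * g i (intIterate T (-D * r) x),
      fun i => ((hg i).comp_intIterate hT _).conj.one_mul_one ((hg i).comp_intIterate hT _),
      fun n => ?_⟩
    have hb := (bddBy_correlation hT hf hg (D * (n + r : ℕ)) (fun i => M i * (n + r : ℕ))).mul
      (bddBy_correlation hT hf hg (D * n) (fun i => M i * n)).conj
    rw [← hb.integral_comp_intIterate hT (-D * r), ← Complex.norm_conj, ← integral_conj]
    congr 2
    ext x
    simp only [← intIterate_natCast, ← intIterate_add, map_mul, map_prod, Finset.prod_mul_distrib,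
      Complex.conj_conj]
    have e1 : ((D.natAbs * r : ℕ) : ℤ) + D * n = D * n + -D * r := by
      push_cast; rw [abs_of_nonpos hD]; ring
    have e2 : ∀ i, (M i - D) * (r : ℤ) + M i * n = M i * (n + r : ℕ) + -D * r := fun i => by
      push_cast; ring
    have e3 : D * ((n + r : ℕ) : ℤ) + -D * r = D * n := by push_cast; ring
    have e4 : ∀ i, -D * (r : ℤ) + M i * n = M i * n + -D * r := fun i => by ring
    simp only [e1, e2, e3, e4]
    ring

/-- Correlations along `k + 1` different linear exponents are controlled by the Host-Kra seminorm of
order `k + 1` of any of the functions. Each van der Corput operation removes one of the other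
functions and raises the order by one. -/
theorem exists_corrLE_hkSeminorm {μ : Measure X} [IsProbabilityMeasure μ] {T : X ≃ᵐ X}
    (hT : MeasurePreserving T μ μ) (k : ℕ) :
    ∀ (M₀ : ℤ) (M : Fin k → ℤ), (∀ i, M i ≠ M₀) → ∃ C : ℝ, 0 ≤ C ∧ ∀ (B : ℝ) (f : X → ℂ),
      BddBy B f → CorrLE μ T f (fun _ n => M₀ * n) (fun i _ n => M i * n)
        (C * hkSeminorm μ T (k + 1) f) := by
  induction k with
  | zero =>
    intro M₀ M _
    refine ⟨1, zero_le_one, fun B f hf ε hε => ?_⟩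
    filter_upwards [eventually_gt_atTop 0] with N hN g _
    have hN' : (0 : ℝ) < N := by exact_mod_cast hN
    have h1 := (norm_integral_le_hkSeminorm_one (μ := μ) T hf).1
    simp only [Finset.univ_eq_empty, Finset.prod_empty, mul_one]
    simp only [hf.integral_comp_intIterate hT, Finset.sum_const, Finset.card_range, nsmul_eq_mul]
    rw [← mul_assoc, one_div_mul_cancel hN'.ne']
    linarith
  | succ k ih =>
    intro M₀ M hM
    obtain ⟨C, hC, hCf⟩ := ih (M₀ - M 0) (fun i => M i.succ - M 0) fun i h =>
      hM i.succ (sub_left_inj.1 h)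
    -- a translation makes the exponent of `g 0` vanish, so that van der Corput's inequality removes it
    set D := M₀ - M 0 with hD
    have hD0 : 0 < D.natAbs := Int.natAbs_pos.2 (sub_ne_zero.2 (hM 0).symm)
    refine ⟨√(4 * C * D.natAbs), by positivity, fun B f hf => ?_⟩
    set a : ℕ → ℝ := fun h => hkSeminorm μ T (k + 1) (fun x => conj (f x) * f (T^[h] x)) with ha
    have ha' : ∀ h, a h ∈ Set.Icc 0 (B ^ 2) := fun h =>
      hkSeminorm_mem_Icc hT k (hf.conj_mul_iterate hT h)
    have hnn : 0 ≤ hkSeminorm μ T (k + 1 + 1) f := (hkSeminorm_mem_Icc hT (k + 1) hf).1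
    set F : ℕ → {g : Fin (k + 1) → X → ℂ // ∀ i, BddBy 1 (g i)} → ℕ → X → ℂ := fun _ g n x =>
      f (intIterate T (D * n) x) *
        ∏ i : Fin k, g.1 i.succ (intIterate T ((M i.succ - M 0) * n) x) with hF
    have hFb : ∀ N g n, BddBy B (F N g n) := fun N g n =>
      bddBy_correlation hT hf (fun i : Fin k => g.2 i.succ) _ (fun i => (M i.succ - M 0) * n)
    have hmain := eventually_avg_le_of_vdc μ
      (δ := √(4 * C * D.natAbs) * hkSeminorm μ T (k + 1 + 1) f) (by positivity) hFb
      (G := fun g => g.1 0) (fun g => g.2 0) (fun r => C * a (D.natAbs * r)) ?_ ?_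
    · intro ε hε
      filter_upwards [hmain ε hε] with N hN g hg
      refine le_of_eq_of_le ?_ (hN ⟨g, hg⟩)
      congr 1
      refine Finset.sum_congr rfl fun n _ => ?_
      congr 1
      rw [← ((hg 0).mul (hFb N ⟨g, hg⟩ n)).integral_comp_intIterate hT (M 0 * n)]
      congr 1
      ext x
      simp only [hF, Fin.prod_univ_succ, ← intIterate_add]
      have e1 : D * (n : ℤ) + M 0 * n = M₀ * n := by rw [hD]; ring
      have e2 : ∀ i : Fin k, (M i.succ - M 0) * (n : ℤ) + M 0 * n = M i.succ * n := fun i => by ring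
      simp only [e1, e2]
      ring
    · intro r ε hε
      filter_upwards [hCf _ _ (hf.conj_mul_iterate hT (D.natAbs * r)) ε hε] with N hN g
      obtain ⟨g', hg', h⟩ := exists_norm_integral_eq hT hf (fun i : Fin k => g.2 i.succ) D
        (fun i => M i.succ - M 0) r
      refine le_of_eq_of_le ?_ (hN g' hg')
      congr 1
      exact Finset.sum_congr rfl fun n _ => h n
    · intro η hη
      obtain ⟨H, hH0, hH⟩ := exists_sum_mul_le_limsup (p := 2 ^ (k + 1)) (d := D.natAbs)
        (fun n => (ha' n).1) (fun n => (ha' n).2) (by positivity) hD0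
        (show 0 ≤ 4 * C by positivity) hη
      refine ⟨H, hH0, ?_⟩
      rw [← Finset.mul_sum, ← mul_assoc, div_mul_eq_mul_div]
      refine hH.trans (add_le_add (le_of_eq ?_) le_rfl)
      rw [mul_pow, Real.sq_sqrt (by positivity)]
      congr 1
      simp only [hkSeminorm]
      have hL : 0 ≤ limsup (fun N : ℕ => (1 / (N : ℝ)) * ∑ n ∈ Finset.Icc 1 N,
          hkSeminorm μ T (k + 1) (fun x => conj (f x) * f (T^[n] x)) ^ 2 ^ (k + 1)) atTop :=
        (limsup_avg_mem_Icc (b := (B ^ 2) ^ 2 ^ (k + 1)) (fun n => pow_nonneg (ha' n).1 _)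
          fun n => pow_le_pow_left₀ (ha' n).1 (ha' n).2 _).1
      rw [← Real.rpow_natCast (_ ^ _) 2, ← Real.rpow_mul hL]
      congr 1
      push_cast
      rw [pow_succ 2 (k + 1)]
      field_simp

end

/-! ### Functions orthogonal to the nilfactor -/

section

variable {X : Type*} [MeasurableSpace X]

theorem exists_bddBy_ae_eq {μ : Measure X} {f : X → ℂ} (hf : MemLp f ∞ μ) :
    ∃ B f', BddBy B f' ∧ f =ᵐ[μ] f' := by
  set B := (eLpNormEssSup f μ).toReal with hB
  have h1 : ∀ᵐ x ∂μ, ‖f x‖ ≤ B := by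
    have h2 : eLpNormEssSup f μ ≠ ∞ := by simpa using hf.eLpNorm_ne_top
    filter_upwards [enorm_ae_le_eLpNormEssSup f μ] with x hx
    rw [← toReal_enorm]
    exact ENNReal.toReal_mono h2 hx
  have hfm := hf.aestronglyMeasurable.stronglyMeasurable_mk.measurable
  refine ⟨B, fun x => if ‖hf.aestronglyMeasurable.mk f x‖ ≤ B then
    hf.aestronglyMeasurable.mk f x else 0, ⟨?_, fun x => ?_⟩, ?_⟩
  · exact Measurable.ite (measurableSet_le hfm.norm measurable_const) hfm measurable_const
  · beta_reduce
    split_ifs with h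
    · exact h
    · rw [norm_zero]; exact ENNReal.toReal_nonneg
  · filter_upwards [h1, hf.aestronglyMeasurable.ae_eq_mk] with x hx hx'
    rw [← hx', if_pos hx]

/-- Averages of correlations of `f` can be written as integrals `∫ f D` against a function bounded
by `1`, and integrals of other functions against `D` are bounded by their correlations. -/
theorem exists_dual_function {μ : Measure X} [IsProbabilityMeasure μ] {T : X ≃ᵐ X}
    (hT : MeasurePreserving T μ μ) {ι : Type*} [Fintype ι] (M₀ : ℤ) (M : ι → ℤ) {B : ℝ} {f : X → ℂ}
    (hf : BddBy B f) {g : ι → X → ℂ} (hg : ∀ i, BddBy 1 (g i)) (N : ℕ) :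
    ∃ D : X → ℂ, BddBy 1 D ∧
      (1 / (N : ℝ)) * ∑ n ∈ Finset.range N, ‖∫ x, f (intIterate T (M₀ * n) x) *
        ∏ i, g i (intIterate T (M i * n) x) ∂μ‖ ≤ ‖∫ x, f x * D x ∂μ‖ ∧
      ∀ (B' : ℝ) (f' : X → ℂ), BddBy B' f' → ‖∫ x, f' x * D x ∂μ‖ ≤
        (1 / (N : ℝ)) * ∑ n ∈ Finset.range N, ‖∫ x, f' (intIterate T (M₀ * n) x) *
          ∏ i, g i (intIterate T (M i * n) x) ∂μ‖ := by
  choose c hc1 hc2 using exists_norm_le_one_mul_eq_norm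
  set w : ℕ → ℂ := fun n => c (∫ x, f (intIterate T (M₀ * n) x) *
        ∏ i, g i (intIterate T (M i * n) x) ∂μ) with hw
  set P : ℕ → X → ℂ := fun n x => ∏ i, g i (intIterate T ((M i - M₀) * n) x) with hP
  have hPb : ∀ n, BddBy 1 (P n) := fun n => BddBy.prod _ fun i _ => (hg i).comp_intIterate hT _
  have hwP : ∀ n ∈ Finset.range N, BddBy 1 (fun x => w n * P n x) := fun n _ => by
    simpa using (hPb n).const_mul (hc1 _)
  have hD : BddBy 1 (fun x => (1 / (N : ℂ)) * ∑ n ∈ Finset.range N, w n * P n x) := by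
    have h1 := (BddBy.sum (Finset.range N) hwP).const_mul (c := 1 / (N : ℝ)) (w := 1 / (N : ℂ))
      (by simp)
    refine ⟨h1.1, fun x => (h1.2 x).trans ?_⟩
    rw [Finset.card_range, mul_one]
    rcases N.eq_zero_or_pos with rfl | hN
    · simp
    · rw [one_div_mul_cancel (by exact_mod_cast hN.ne')]
  have hint : ∀ (B' : ℝ) (f' : X → ℂ), BddBy B' f' →
      ∫ x, f' x * ((1 / (N : ℂ)) * ∑ n ∈ Finset.range N, w n * P n x) ∂μ =
        (1 / (N : ℂ)) * ∑ n ∈ Finset.range N, w n * ∫ x, f' (intIterate T (M₀ * n) x) *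
          ∏ i, g i (intIterate T (M i * n) x) ∂μ := by
    intro B' f' hf'
    have e : ∀ x, f' x * ((1 / (N : ℂ)) * ∑ n ∈ Finset.range N, w n * P n x) =
        (1 / (N : ℂ)) * ∑ n ∈ Finset.range N, w n * (f' x * P n x) := by
      intro x
      rw [mul_left_comm, Finset.mul_sum]
      congr 1
      exact Finset.sum_congr rfl fun n _ => by ring
    simp_rw [e]
    rw [integral_const_mul, integral_finsetSum]
    · congr 1
      refine Finset.sum_congr rfl fun n _ => ?_
      rw [integral_const_mul, ← (hf'.mul (hPb n)).integral_comp_intIterate hT (M₀ * n)]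
      congr 2
      ext x
      congr 1
      refine Finset.prod_congr rfl fun i _ => ?_
      rw [← intIterate_add]
      congr 2; ring
    · exact fun n _ => ((hf'.mul (hPb n)).integrable μ).const_mul _
  refine ⟨_, hD, le_of_eq ?_, fun B' f' hf' => ?_⟩
  · rw [hint B f hf]
    simp only [hw, hc2]
    rw [← Complex.ofReal_sum, norm_mul, Complex.norm_real, Real.norm_of_nonneg (by positivity)]
    simp
  · rw [hint B' f' hf', norm_mul]
    have : ‖(1 / (N : ℂ))‖ = 1 / (N : ℝ) := by simp
    rw [this]
    gcongr
    refine (norm_sum_le _ _).trans (Finset.sum_le_sum fun n _ => ?_)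
    rw [norm_mul]
    exact mul_le_of_le_one_left (norm_nonneg _) (hc1 _)

/-- A sequence of functions bounded by `1` has a weak limit along any ultrafilter, which is again
bounded by `1`. -/
theorem exists_weak_limit (μ : Measure X) [IsProbabilityMeasure μ] (U : Ultrafilter ℕ)
    {D : ℕ → X → ℂ} (hD : ∀ N, BddBy 1 (D N)) :
    ∃ E : X → ℂ, Measurable E ∧ (∀ᵐ x ∂μ, ‖E x‖ ≤ 1) ∧ ∀ (B : ℝ) (f : X → ℂ), BddBy B f →
      Tendsto (fun N => ∫ x, f x * D N x ∂μ) U (𝓝 (∫ x, f x * E x ∂μ)) := by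
  have hmem : ∀ {B : ℝ} {f : X → ℂ}, BddBy B f → MemLp f 2 μ := fun {B f} hf =>
    MemLp.of_bound hf.1.aestronglyMeasurable B (ae_of_all _ hf.2)
  set d : ℕ → Lp ℂ 2 μ := fun N => (hmem (hD N).conj).toLp with hd
  set Φ : ℕ → WeakDual ℂ (Lp ℂ 2 μ) := fun N =>
    StrongDual.toWeakDual (InnerProductSpace.toDual ℂ (Lp ℂ 2 μ) (d N)) with hΦ
  have hball : ∀ N, Φ N ∈ WeakDual.toStrongDual ⁻¹'
      (Metric.closedBall (0 : StrongDual ℂ (Lp ℂ 2 μ)) 1) := by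
    intro N
    simp only [hΦ, Set.mem_preimage, mem_closedBall_zero_iff]
    change ‖InnerProductSpace.toDual ℂ (Lp ℂ 2 μ) (d N)‖ ≤ 1
    rw [LinearIsometryEquiv.norm_map]
    refine (Lp.norm_le_of_ae_bound zero_le_one ?_).trans (by simp [measureUnivNNReal])
    filter_upwards [(hmem (hD N).conj).coeFn_toLp] with x hx
    rw [hd]; dsimp only; rw [hx]; exact (hD N).conj.2 x
  obtain ⟨ℓ, _, hℓ⟩ := (WeakDual.isCompact_closedBall (𝕜 := ℂ)
    (0 : StrongDual ℂ (Lp ℂ 2 μ)) 1).ultrafilter_le_nhds (U.map Φ)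
      (by rw [le_principal_iff]; exact Filter.mem_map.2 (univ_mem' hball))
  set e : Lp ℂ 2 μ := (InnerProductSpace.toDual ℂ (Lp ℂ 2 μ)).symm (WeakDual.toStrongDual ℓ) with he
  have hem : Measurable (e : X → ℂ) := (Lp.stronglyMeasurable e).measurable
  have hEi : Integrable (fun x => conj (e x)) μ :=
    (RCLike.conjCLE (K := ℂ)).toContinuousLinearMap.integrable_comp
      ((Lp.memLp e).integrable (by norm_num))
  have hlim : ∀ (B : ℝ) (f : X → ℂ), BddBy B f →
      Tendsto (fun N => ∫ x, f x * D N x ∂μ) U (𝓝 (∫ x, f x * conj (e x) ∂μ)) := by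
    intro B f hf
    have h1 : Tendsto (fun N => Φ N ((hmem hf).toLp)) U (𝓝 (ℓ ((hmem hf).toLp))) :=
      ((WeakDual.eval_continuous _).tendsto ℓ).comp hℓ
    have h2 : ∀ N, Φ N ((hmem hf).toLp) = ∫ x, f x * D N x ∂μ := by
      intro N
      change inner ℂ (d N) ((hmem hf).toLp) = _
      rw [L2.inner_def]
      refine integral_congr_ae ?_
      filter_upwards [(hmem (hD N).conj).coeFn_toLp, (hmem hf).coeFn_toLp] with x hx hx'
      rw [hd]; dsimp only; rw [hx, hx']; simp
    have h3 : ℓ ((hmem hf).toLp) = ∫ x, f x * conj (e x) ∂μ := by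
      have : ℓ ((hmem hf).toLp) = inner ℂ e ((hmem hf).toLp) := by
        rw [he, InnerProductSpace.toDual_symm_apply]; rfl
      rw [this, L2.inner_def]
      refine integral_congr_ae ?_
      filter_upwards [(hmem hf).coeFn_toLp] with x hx'
      rw [hx']; simp
    simpa only [h2, h3] using h1
  refine ⟨fun x => conj (e x), Complex.continuous_conj.measurable.comp hem, ?_, hlim⟩
  -- test the limit against the phase of `E` on the set where `‖E‖ > 1`
  set A : Set X := {x | 1 < ‖e x‖} with hA
  have hAm : MeasurableSet A := measurableSet_lt measurable_const hem.norm
  set h : X → ℂ := A.indicator (fun x => e x / ‖e x‖) with hh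
  have hhb : BddBy 1 h := by
    refine ⟨Measurable.indicator (hem.div (Complex.measurable_ofReal.comp hem.norm)) hAm,
      fun x => ?_⟩
    by_cases hx : x ∈ A
    · rw [hh, Set.indicator_of_mem hx, norm_div]; simp [div_self_le_one]
    · rw [hh, Set.indicator_of_notMem hx]; simp
  have h1 : ‖∫ x, h x * conj (e x) ∂μ‖ ≤ ∫ x, ‖h x‖ ∂μ := by
    refine le_of_tendsto (hlim 1 h hhb).norm (Eventually.of_forall fun N => ?_)
    refine (norm_integral_le_integral_norm _).trans ?_
    refine integral_mono ((hhb.mul (hD N)).integrable μ).norm (hhb.integrable μ).norm fun x => ?_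
    simp only [norm_mul]
    exact mul_le_of_le_one_right (norm_nonneg _) ((hD N).2 x)
  have h2 : ∀ x, h x * conj (e x) = ((A.indicator (fun x => ‖e x‖) x : ℝ) : ℂ) := by
    intro x
    by_cases hx : x ∈ A
    · rw [hh, Set.indicator_of_mem hx, Set.indicator_of_mem hx, div_mul_eq_mul_div,
        Complex.mul_conj', sq, mul_div_assoc, div_self, mul_one]
      have : (1 : ℝ) < ‖e x‖ := hx
      exact_mod_cast (by linarith : ‖e x‖ ≠ 0)
    · rw [hh, Set.indicator_of_notMem hx, Set.indicator_of_notMem hx]; simp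
  have h3 : ∀ x, ‖h x‖ = A.indicator (fun _ => (1 : ℝ)) x := by
    intro x
    by_cases hx : x ∈ A
    · have : (1 : ℝ) < ‖e x‖ := hx
      rw [hh, Set.indicator_of_mem hx, Set.indicator_of_mem hx, norm_div, Complex.norm_real,
        norm_norm, div_self (by linarith)]
    · rw [hh, Set.indicator_of_notMem hx, Set.indicator_of_notMem hx]; simp
  simp_rw [h2, h3] at h1
  rw [integral_complex_ofReal, Complex.norm_real, Real.norm_of_nonneg
    (integral_nonneg fun x => Set.indicator_nonneg (fun _ _ => norm_nonneg _) x)] at h1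
  have hen : Integrable (fun x => ‖e x‖) μ := by simpa using hEi.norm
  have h4 : ∫ x, A.indicator (fun x => ‖e x‖ - 1) x ∂μ ≤ 0 := by
    have : ∀ x, A.indicator (fun x => ‖e x‖ - 1) x =
        A.indicator (fun x => ‖e x‖) x - A.indicator (fun _ => (1 : ℝ)) x := fun x =>
      congrFun (Set.indicator_sub A _ _) x
    simp_rw [this]
    rw [integral_sub (hen.indicator hAm) ((integrable_const _).indicator hAm)]
    linarith
  have h5 : 0 ≤ fun x => A.indicator (fun x => ‖e x‖ - 1) x := fun x =>
    Set.indicator_nonneg (fun y hy => by have : (1 : ℝ) < ‖e y‖ := hy; simp; linarith) x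
  have h6 := (integral_eq_zero_iff_of_nonneg h5
    ((hen.sub (integrable_const _)).indicator hAm)).1 (le_antisymm h4 (integral_nonneg h5))
  filter_upwards [h6] with x hx
  by_contra hcon
  have hxA : 1 < ‖e x‖ := by simpa using hcon
  have hx' : A.indicator (fun x => ‖e x‖ - 1) x = 0 := hx
  rw [Set.indicator_of_mem (show x ∈ A from hxA)] at hx'
  linarith

/-- Functions orthogonal to the nilfactor have vanishing correlations along distinct linear
exponents: otherwise a weak limit of dual functions correlates with `f`, but it is orthogonal to
all functions with vanishing seminorm, hence measurable with respect to the nilfactor. -/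
theorem corrLE_zero_of_condExp_nilfactor {μ : Measure X} [IsProbabilityMeasure μ] {T : X ≃ᵐ X}
    (hT : MeasurePreserving T μ μ) {B : ℝ} {f : X → ℂ} (hf : BddBy B f)
    (hf0 : μ[f | nilfactor μ T] =ᵐ[μ] 0) {k : ℕ} {M₀ : ℤ} {M : Fin (k + 1) → ℤ}
    (hM : ∀ i, M i ≠ M₀) :
    CorrLE μ T f (fun _ n => M₀ * n) (fun i _ n => M i * n) 0 := by
  by_contra hcon
  unfold CorrLE at hcon
  push Not at hcon
  obtain ⟨ε, hε, hfreq⟩ := hcon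
  rw [zero_add] at hfreq
  have hex : ∀ N : ℕ, ∃ g : Fin (k + 1) → X → ℂ, (∀ i, BddBy 1 (g i)) ∧
      ((∃ g : Fin (k + 1) → X → ℂ, (∀ i, BddBy 1 (g i)) ∧ ε < (1 / (N : ℝ)) *
        ∑ n ∈ Finset.range N, ‖∫ x, f (intIterate T (M₀ * n) x) *
          ∏ i, g i (intIterate T (M i * n) x) ∂μ‖) →
        ε < (1 / (N : ℝ)) * ∑ n ∈ Finset.range N, ‖∫ x, f (intIterate T (M₀ * n) x) *
          ∏ i, g i (intIterate T (M i * n) x) ∂μ‖) := by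
    intro N
    by_cases h : ∃ g : Fin (k + 1) → X → ℂ, (∀ i, BddBy 1 (g i)) ∧ ε < (1 / (N : ℝ)) *
        ∑ n ∈ Finset.range N, ‖∫ x, f (intIterate T (M₀ * n) x) *
          ∏ i, g i (intIterate T (M i * n) x) ∂μ‖
    · obtain ⟨g, hg, hg'⟩ := h
      exact ⟨g, hg, fun _ => hg'⟩
    · exact ⟨fun _ _ => 0, fun _ => ⟨measurable_const, by simp⟩, fun h' => absurd h' h⟩
  choose g hg hgε using hex
  choose D hD hDf hDn using fun N => exists_dual_function hT M₀ M hf (hg N) N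
  set S : Set ℕ := {N | ε < ‖∫ x, f x * D N x ∂μ‖} with hS
  have hSfreq : ∃ᶠ N in atTop, N ∈ S := hfreq.mono fun N hN => (hgε N hN).trans_le (hDf N)
  have : NeBot (atTop ⊓ 𝓟 S) := frequently_mem_iff_neBot.1 hSfreq
  set U : Ultrafilter ℕ := Ultrafilter.of (atTop ⊓ 𝓟 S) with hU
  have hUle : (U : Filter ℕ) ≤ atTop ⊓ 𝓟 S := Ultrafilter.of_le _
  have hUtop : (U : Filter ℕ) ≤ atTop := hUle.trans inf_le_left
  have hUS : ∀ᶠ N in (U : Filter ℕ), N ∈ S := hUle (mem_inf_of_right (mem_principal_self S))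
  obtain ⟨E, hEm, hE1, hElim⟩ := exists_weak_limit μ U hD
  have hEL : MemLp E ∞ μ := memLp_top_of_bound hEm.aestronglyMeasurable 1 hE1
  -- there are `k + 2` exponents, so the seminorm of order `k + 2` controls the correlations
  have hEorth : IsOrthogonalToNull μ T (k + 2) E := by
    refine ⟨hEm, hEL, fun f' hf' hnull => ?_⟩
    obtain ⟨B', f'', hf'', hae⟩ := exists_bddBy_ae_eq hf'
    rw [hkSeminorm_congr_ae hT _ hae] at hnull
    obtain ⟨C, _, hC⟩ := exists_corrLE_hkSeminorm hT (k + 1) M₀ M hM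
    have hcorr := hC B' f'' hf''
    rw [hnull, mul_zero] at hcorr
    have hzero : Tendsto (fun N => ∫ x, f'' x * D N x ∂μ) atTop (𝓝 0) := by
      rw [Metric.tendsto_nhds]
      intro η hη
      filter_upwards [hcorr (η / 2) (by positivity)] with N hN
      rw [dist_zero_right]
      linarith [(hDn N B' f'' hf'').trans (hN (g N) (hg N))]
    rw [← tendsto_nhds_unique (hElim B' f'' hf'') (hzero.mono_left hUtop)]
    refine integral_congr_ae ?_
    filter_upwards [hae] with x hx
    rw [hx, mul_comm]
  have hEZ : Measurable[nilfactor μ T] E := by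
    have h1 : (borel ℂ).comap E ≤ nilfactor μ T :=
      (le_iSup (fun g : {g : X → ℂ // IsOrthogonalToNull μ T (k + 1 + 1) g} =>
        (borel ℂ).comap g.1) ⟨E, hEorth⟩).trans (le_iSup (fun k => stepNilfactor μ T (k + 1)) k)
    rw [← BorelSpace.measurable_eq (α := ℂ)] at h1
    exact measurable_iff_comap_le.2 h1
  have hfE : Integrable (fun x => f x * E x) μ :=
    (hf.integrable μ).mul_bdd (c := 1) hEm.aestronglyMeasurable hE1
  have hint : ∫ x, f x * E x ∂μ = 0 := by
    rw [← integral_condExp (nilfactor_le μ T)]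
    have h1 := condExp_bilin_of_stronglyMeasurable_right (ContinuousLinearMap.mul ℝ ℂ)
      hEZ.stronglyMeasurable (by simpa using hfE) (hf.integrable μ)
    simp only [ContinuousLinearMap.mul_apply'] at h1
    rw [integral_congr_ae h1]
    refine integral_eq_zero_of_ae ?_
    filter_upwards [hf0] with x hx
    simp [hx]
  have hle : ε ≤ ‖∫ x, f x * E x ∂μ‖ :=
    ge_of_tendsto (hElim B f hf).norm (hUS.mono fun N hN => hN.le)
  rw [hint, norm_zero] at hle
  linarith

end

/-! ### Difference operators -/

/-- The integer polynomial `L` applied to the forward difference operator on sequences of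
integers. -/
noncomputable def diffOp (L : Polynomial ℤ) (m : ℕ → ℤ) : ℕ → ℤ :=
  Polynomial.aeval (fwdDiff_aux.fwdDiffₗ ℕ ℤ 1) L m

theorem diffOp_sub (L L' : Polynomial ℤ) (m : ℕ → ℤ) (n : ℕ) :
    diffOp (L - L') m n = diffOp L m n - diffOp L' m n := by
  simp [diffOp]

theorem diffOp_add (L L' : Polynomial ℤ) (m : ℕ → ℤ) (n : ℕ) :
    diffOp (L + L') m n = diffOp L m n + diffOp L' m n := by
  simp [diffOp]

theorem diffOp_C_mul (a : ℤ) (L : Polynomial ℤ) (m : ℕ → ℤ) (n : ℕ) :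
    diffOp (Polynomial.C a * L) m n = a * diffOp L m n := by
  simp [diffOp]

theorem diffOp_X_pow_mul (L : Polynomial ℤ) (k : ℕ) (m : ℕ → ℤ) :
    diffOp (Polynomial.X ^ k * L) m = diffOp L ((fwdDiff 1)^[k] m) := by
  rw [diffOp, mul_comm, map_mul, map_pow, Polynomial.aeval_X, Module.End.mul_apply, diffOp,
    fwdDiff_aux.coe_fwdDiffₗ_pow]

theorem diffOp_X_pow (k : ℕ) (m : ℕ → ℤ) : diffOp (Polynomial.X ^ k) m = (fwdDiff 1)^[k] m := by
  rw [← mul_one (Polynomial.X ^ k), diffOp_X_pow_mul]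
  simp [diffOp]

theorem diffOp_C (a : ℤ) (m : ℕ → ℤ) (n : ℕ) : diffOp (Polynomial.C a) m n = a * m n := by
  rw [← mul_one (Polynomial.C a), diffOp_C_mul]
  simp [diffOp]

theorem diffOp_one_add_X_pow_mul (L : Polynomial ℤ) (r : ℕ) (m : ℕ → ℤ) (n : ℕ) :
    diffOp ((1 + Polynomial.X) ^ r * L) m n = diffOp L m (n + r) := by
  rw [diffOp, map_mul, map_pow, map_add, map_one, Polynomial.aeval_X, add_comm,
    Module.End.mul_apply]
  exact (fwdDiff_aux.shiftₗ_pow_apply 1 _ r n).trans (by simp [diffOp])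

theorem exists_abs_diffOp_le (L : Polynomial ℤ) (C : ℤ) :
    ∃ C' : ℤ, 0 ≤ C' ∧ ∀ m : ℕ → ℤ, (∀ n, |m n| ≤ C) → ∀ n, |diffOp L m n| ≤ C' := by
  have hpow : ∀ (k : ℕ) (m : ℕ → ℤ), (∀ n, |m n| ≤ C) → ∀ n, |(fwdDiff 1)^[k] m n| ≤ 2 ^ k * C := by
    intro k
    induction k with
    | zero => intro m hm n; simpa using hm n
    | succ k ih =>
      intro m hm n
      rw [Function.iterate_succ_apply', fwdDiff]
      have h1 := ih m hm (n + 1)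
      have h2 := ih m hm n
      refine (abs_sub _ _).trans ?_
      rw [pow_succ]; linarith
  induction L using Polynomial.induction_on' with
  | add p q hp hq =>
    obtain ⟨A, hA0, hA⟩ := hp
    obtain ⟨A', hA0', hA'⟩ := hq
    refine ⟨A + A', by positivity, fun m hm n => ?_⟩
    rw [diffOp_add]
    exact (abs_add_le _ _).trans (add_le_add (hA m hm n) (hA' m hm n))
  | monomial k a =>
    refine ⟨|a| * |2 ^ k * C|, by positivity, fun m hm n => ?_⟩
    rw [← Polynomial.C_mul_X_pow_eq_monomial, diffOp_C_mul, diffOp_X_pow, abs_mul]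
    exact mul_le_mul_of_nonneg_left ((hpow k m hm n).trans (le_abs_self _)) (abs_nonneg a)

/-- If only the coefficients of `L` at `d` and above survive, `L` maps sequences with bounded `d`-th
differences to bounded sequences. -/
theorem exists_abs_diffOp_le_of_coeff {L : Polynomial ℤ} {d : ℕ} (hL : ∀ j < d, L.coeff j = 0)
    (C : ℤ) : ∃ C' : ℤ, 0 ≤ C' ∧ ∀ m : ℕ → ℤ, (∀ n, |(fwdDiff 1)^[d] m n| ≤ C) →
      ∀ n, |diffOp L m n| ≤ C' := by
  obtain ⟨Q, rfl⟩ := Polynomial.X_pow_dvd_iff.2 hL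
  obtain ⟨C', h0, h⟩ := exists_abs_diffOp_le Q C
  exact ⟨C', h0, fun m hm n => by rw [diffOp_X_pow_mul]; exact h _ hm n⟩

theorem exists_abs_diffOp_sub_le_of_coeff {L : Polynomial ℤ} {d : ℕ}
    (hL : ∀ j < d, L.coeff j = 0) (C : ℤ) :
    ∃ C' : ℤ, 0 ≤ C' ∧ ∀ m : ℕ → ℤ, (∀ n, |(fwdDiff 1)^[d + 1] m n| ≤ C) →
      ∀ n, |diffOp L m n - L.coeff d * (fwdDiff 1)^[d] m n| ≤ C' := by
  have h1 : ∀ j < d + 1, (L - Polynomial.C (L.coeff d) * Polynomial.X ^ d).coeff j = 0 := by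
    intro j hj
    rw [Polynomial.coeff_sub, Polynomial.coeff_C_mul, Polynomial.coeff_X_pow]
    rcases (Nat.lt_succ_iff.1 hj).lt_or_eq with h | rfl
    · simp [hL j h, h.ne]
    · simp
  obtain ⟨C', h0, h⟩ := exists_abs_diffOp_le_of_coeff h1 C
  refine ⟨C', h0, fun m hm n => ?_⟩
  have := h m hm n
  rwa [diffOp_sub, diffOp_C_mul, diffOp_X_pow] at this

/-! ### Trailing coefficients under shifts -/

section Coeff

variable {P : Polynomial ℤ} {m : ℕ}

theorem one_add_X_pow_coeff_zero (r : ℕ) :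
    ((1 + Polynomial.X : Polynomial ℤ) ^ r).coeff 0 = 1 := by
  rw [Polynomial.coeff_zero_eq_eval_zero]; simp

theorem coeff_one_add_X_pow_mul_of_lt (h : ∀ j < m, P.coeff j = 0) (r : ℕ) :
    ∀ j < m, ((1 + Polynomial.X) ^ r * P).coeff j = 0 :=
  Polynomial.X_pow_dvd_iff.1 ((Polynomial.X_pow_dvd_iff.2 h).mul_left _)

theorem coeff_one_add_X_pow_mul_self (h : ∀ j < m, P.coeff j = 0) (r : ℕ) :
    ((1 + Polynomial.X) ^ r * P).coeff m = P.coeff m := by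
  obtain ⟨Q, rfl⟩ := Polynomial.X_pow_dvd_iff.2 h
  have h1 : ∀ R : Polynomial ℤ, (Polynomial.X ^ m * R).coeff m = R.coeff 0 := fun R => by
    simpa using Polynomial.coeff_X_pow_mul R m 0
  rw [mul_left_comm, h1, h1, Polynomial.mul_coeff_zero, one_add_X_pow_coeff_zero, one_mul]

theorem coeff_one_add_X_pow_mul_succ (h : ∀ j < m, P.coeff j = 0) (r : ℕ) :
    ((1 + Polynomial.X) ^ r * P).coeff (m + 1) = P.coeff (m + 1) + r * P.coeff m := by
  obtain ⟨Q, rfl⟩ := Polynomial.X_pow_dvd_iff.2 h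
  have h1 : (Polynomial.X ^ m * Q).coeff m = Q.coeff 0 := by
    simpa using Polynomial.coeff_X_pow_mul Q m 0
  rw [mul_left_comm, add_comm m 1, Polynomial.coeff_X_pow_mul, Polynomial.coeff_X_pow_mul, h1,
    Polynomial.mul_coeff_one, one_add_X_pow_coeff_zero, Polynomial.coeff_one_add_X_pow]
  simp

theorem coeff_one_add_X_pow_mul_iff (r : ℕ) :
    (∀ j < m, ((1 + Polynomial.X) ^ r * P).coeff j = 0) ↔ ∀ j < m, P.coeff j = 0 := by
  refine ⟨fun h => ?_, fun h => coeff_one_add_X_pow_mul_of_lt h r⟩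
  intro j
  induction j using Nat.strong_induction_on with
  | _ j ih =>
    intro hj
    rw [← coeff_one_add_X_pow_mul_self (fun i hi => ih i hi (hi.trans hj)) r]
    exact h j hj

theorem exists_coeff_one_add_X_pow_mul_ne_zero {d : ℕ} (h : ∃ j < d, P.coeff j ≠ 0) (r : ℕ) :
    ∃ j < d, ((1 + Polynomial.X) ^ r * P).coeff j ≠ 0 := by
  by_contra! hcon
  obtain ⟨j, hj, hne⟩ := h
  exact hne ((coeff_one_add_X_pow_mul_iff r).1 hcon j hj)

end Coeff

/-! ### Induction on the exponents -/

/-- The hypotheses on the exponents `L₀` (the target) and `L i` which are preserved by suitable van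
der Corput operations. An operator `L` lowers the degree of a polynomial by the order of vanishing of
`L` at `0`, so a smaller order means a larger degree. The condition says that the target has order
`m₀ < d`, which is minimal in the family, and that `L₀`, `L i` and `L₀ - L i` all have order less than
`d`: applied to a polynomial of degree `d`, they give nonconstant polynomials. -/
structure ExponentCondition {ι : Type*} (d m₀ : ℕ) (L₀ : Polynomial ℤ) (L : ι → Polynomial ℤ) :
    Prop where
  lt : m₀ < d
  low_target : ∀ j < m₀, L₀.coeff j = 0
  lead_target : L₀.coeff m₀ ≠ 0
  low : ∀ i, ∀ j < m₀, (L i).coeff j = 0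
  nonconst : ∀ i, ∃ j < d, (L i).coeff j ≠ 0
  distinct : ∀ i, ∃ j < d, (L i).coeff j ≠ L₀.coeff j

/-- The nonzero coefficients of order `m` of the members of order at least `m`, that is the leading
coefficients of the members of order `m`. -/
def trailingCoeffs {κ : Type*} (s : κ → Polynomial ℤ) (m : ℕ) : Set ℤ :=
  {c | c ≠ 0 ∧ ∃ k, (∀ j < m, (s k).coeff j = 0) ∧ (s k).coeff m = c}

theorem finite_trailingCoeffs {κ : Type*} [Finite κ] (s : κ → Polynomial ℤ) (m : ℕ) :
    (trailingCoeffs s m).Finite :=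
  (Set.finite_range fun k => (s k).coeff m).subset fun _ ⟨_, k, _, hk⟩ => ⟨k, hk⟩

/-- The weight of a family: the number of leading coefficients in each order below `d`. Weights are
compared lexicographically. -/
noncomputable def familyWeight {κ : Type*} (d : ℕ) (s : κ → Polynomial ℤ) : Fin d → ℕ :=
  fun m => (trailingCoeffs s m).ncard

/-- The members of a family after a van der Corput operation with shift `r` which subtracts `q`, apart
from the new target `(1 + X) ^ r * L₀ - q`. -/
noncomputable def vdcFamily {ι : Type*} (L₀ : Polynomial ℤ) (L : ι → Polynomial ℤ)
    (q : Polynomial ℤ) (r : ℕ) : Option ι ⊕ ι → Polynomial ℤ :=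
  Sum.elim (fun o => o.elim L₀ L - q) (fun i => (1 + Polynomial.X) ^ r * L i - q)

/-- The members of `vdcFamily` which give nonconstant polynomials. -/
abbrev VdcIndex {ι : Type*} (d : ℕ) (L₀ : Polynomial ℤ) (L : ι → Polynomial ℤ) (q : Polynomial ℤ)
    (r : ℕ) : Type _ :=
  {x : Option ι ⊕ ι // ∃ j < d, (vdcFamily L₀ L q r x).coeff j ≠ 0}

section

variable {ι : Type*} {d m₀ : ℕ} {L₀ : Polynomial ℤ} {L : ι → Polynomial ℤ}

theorem ExponentCondition.elim_nonconst (h : ExponentCondition d m₀ L₀ L) (k : Option ι) :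
    ∃ j < d, (k.elim L₀ L).coeff j ≠ 0 := by
  cases k with
  | none => exact ⟨m₀, h.lt, h.lead_target⟩
  | some i => exact h.nonconst i

theorem ExponentCondition.elim_low (h : ExponentCondition d m₀ L₀ L) (k : Option ι) :
    ∀ j < m₀, (k.elim L₀ L).coeff j = 0 := by
  cases k with
  | none => exact h.low_target
  | some i => exact h.low i

/-- The member to be subtracted: one of maximal order, with a leading coefficient different from that
of the target if there is a member of this kind, and the target itself otherwise. -/
theorem ExponentCondition.exists_pivot [Finite ι] (h : ExponentCondition d m₀ L₀ L) :
    ∃ (k₀ : Option ι) (m : ℕ), m < d ∧ (k₀.elim L₀ L).coeff m ≠ 0 ∧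
      (∀ j < m, (k₀.elim L₀ L).coeff j = 0) ∧
      (∀ k : Option ι, ∃ j ≤ m, (k.elim L₀ L).coeff j ≠ 0) ∧
      ((k₀.elim L₀ L).coeff m₀ ≠ L₀.coeff m₀ ∨
        k₀ = none ∧ m = m₀ ∧ ∀ k : Option ι, (k.elim L₀ L).coeff m₀ = L₀.coeff m₀) := by
  classical
  set s : Option ι → Polynomial ℤ := fun k => k.elim L₀ L with hs
  by_cases hall : ∀ k, (s k).coeff m₀ = L₀.coeff m₀
  · exact ⟨none, m₀, h.lt, h.lead_target, h.low_target,
      fun k => ⟨m₀, le_rfl, by rw [show (k.elim L₀ L).coeff m₀ = _ from hall k]; exact h.lead_target⟩,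
      Or.inr ⟨rfl, rfl, hall⟩⟩
  push Not at hall
  obtain ⟨k₁, hk₁⟩ := hall
  have hex : ∀ k, ∃ j, (s k).coeff j ≠ 0 := fun k =>
    let ⟨j, _, hj⟩ := h.elim_nonconst k; ⟨j, hj⟩
  set o : Option ι → ℕ := fun k => Nat.find (hex k) with ho
  have ho1 : ∀ k, (s k).coeff (o k) ≠ 0 := fun k => Nat.find_spec (hex k)
  have ho2 : ∀ k, ∀ j < o k, (s k).coeff j = 0 := fun k j hj => by
    simpa using Nat.find_min (hex k) hj
  have hod : ∀ k, o k < d := fun k =>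
    let ⟨j, hj, hne⟩ := h.elim_nonconst k; (Nat.find_min' (hex k) hne).trans_lt hj
  have hom : ∀ k, m₀ ≤ o k := fun k => by
    by_contra hlt
    exact ho1 k (h.elim_low k _ (not_le.1 hlt))
  obtain ⟨k₂, hk₂⟩ := Finite.exists_max o
  rcases (hom k₂).lt_or_eq with hlt | heq
  · refine ⟨k₂, o k₂, hod k₂, ho1 k₂, ho2 k₂, fun k => ⟨o k, hk₂ k, ho1 k⟩, Or.inl ?_⟩
    rw [show (k₂.elim L₀ L).coeff m₀ = 0 from ho2 k₂ _ hlt]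
    exact h.lead_target.symm
  · have hk₁' : o k₁ = m₀ := le_antisymm ((hk₂ k₁).trans heq.symm.le) (hom k₁)
    exact ⟨k₁, o k₁, hod k₁, ho1 k₁, ho2 k₁, fun k => ⟨o k, (hk₂ k).trans (by omega), ho1 k⟩,
      Or.inl hk₁⟩

theorem exists_eq_vdcFamily (q : Polynomial ℤ) (r : ℕ) (k : Option (VdcIndex d L₀ L q r)) :
    ∃ (a : ℕ) (k' : Option ι), k.elim ((1 + Polynomial.X) ^ r * L₀ - q)
      (fun x => vdcFamily L₀ L q r x) = (1 + Polynomial.X) ^ a * k'.elim L₀ L - q := by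
  rcases k with _ | ⟨(o | i), _⟩
  · exact ⟨r, none, rfl⟩
  · exact ⟨0, o, by rw [pow_zero, one_mul]; rfl⟩
  · exact ⟨r, some i, rfl⟩

/-- For a sufficiently large shift, the new target is distinct from all new members: the shift
changes the coefficient of order `m₀ + 1` of the target by `r` times its leading coefficient, while the
members shifted with the target stay distinct from it. -/
theorem ExponentCondition.exists_shift_distinct [Fintype ι] (h : ExponentCondition d m₀ L₀ L)
    (hd : m₀ + 1 < d) (q : Polynomial ℤ) :
    ∃ r₀ : ℕ, 1 ≤ r₀ ∧ ∀ r, r₀ ≤ r → ∀ x : Option ι ⊕ ι,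
      ∃ j < d, (vdcFamily L₀ L q r x).coeff j ≠ ((1 + Polynomial.X) ^ r * L₀ - q).coeff j := by
  refine ⟨1 + ∑ o : Option ι, ((o.elim L₀ L).coeff (m₀ + 1) - L₀.coeff (m₀ + 1)).natAbs, by omega,
    fun r hr x => ?_⟩
  rcases x with o | i
  · refine ⟨m₀ + 1, hd, fun heq => ?_⟩
    simp only [vdcFamily, Sum.elim_inl, Polynomial.coeff_sub, sub_left_inj,
      coeff_one_add_X_pow_mul_succ h.low_target] at heq
    have h1 : ((o.elim L₀ L).coeff (m₀ + 1) - L₀.coeff (m₀ + 1)).natAbs < r := by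
      have := Finset.single_le_sum (f := fun o : Option ι =>
        ((o.elim L₀ L).coeff (m₀ + 1) - L₀.coeff (m₀ + 1)).natAbs) (fun _ _ => Nat.zero_le _)
        (Finset.mem_univ o)
      omega
    rw [heq, add_sub_cancel_left, Int.natAbs_mul, Int.natAbs_natCast] at h1
    have h2 : 0 < (L₀.coeff m₀).natAbs := Int.natAbs_pos.2 h.lead_target
    nlinarith
  · obtain ⟨j, hj, hne⟩ := exists_coeff_one_add_X_pow_mul_ne_zero (P := L i - L₀)
      (let ⟨j, hj, hne⟩ := h.distinct i
       ⟨j, hj, by rw [Polynomial.coeff_sub]; exact sub_ne_zero.2 hne⟩) r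
    refine ⟨j, hj, ?_⟩
    rw [mul_sub, Polynomial.coeff_sub, sub_ne_zero] at hne
    simpa [vdcFamily] using hne

/-- A van der Corput operation which subtracts a member of maximal order lowers the weight: in the
order of `q` the leading coefficient of `q` disappears, and the orders below do not change. -/
theorem familyWeight_vdcFamily_lt [Finite ι] {k₀ : Option ι} {m : ℕ} (hm : m < d)
    (hq : (k₀.elim L₀ L).coeff m ≠ 0) (hqlow : ∀ j < m, (k₀.elim L₀ L).coeff j = 0)
    (hmax : ∀ k : Option ι, ∃ j ≤ m, (k.elim L₀ L).coeff j ≠ 0) (r : ℕ) :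
    Pi.Lex (· < ·) (· < ·)
      (familyWeight d fun k : Option (VdcIndex d L₀ L (k₀.elim L₀ L) r) =>
        k.elim ((1 + Polynomial.X) ^ r * L₀ - k₀.elim L₀ L)
          (fun x => vdcFamily L₀ L (k₀.elim L₀ L) r x))
      (familyWeight d fun k : Option ι => k.elim L₀ L) := by
  set q := k₀.elim L₀ L with hqdef
  have hlow : ∀ (i : ℕ), i ≤ m → ∀ (a : ℕ) (k' : Option ι),
      (∀ j < i, ((1 + Polynomial.X) ^ a * k'.elim L₀ L - q).coeff j = 0) →
      (∀ j < i, (k'.elim L₀ L).coeff j = 0) ∧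
        ((1 + Polynomial.X) ^ a * k'.elim L₀ L - q).coeff i
          = (k'.elim L₀ L).coeff i - q.coeff i := by
    intro i hi a k' hz
    have h1 : ∀ j < i, (k'.elim L₀ L).coeff j = 0 := by
      refine (coeff_one_add_X_pow_mul_iff a).1 fun j hj => ?_
      have := hz j hj
      rwa [Polynomial.coeff_sub, hqlow j (hj.trans_le hi), sub_zero] at this
    exact ⟨h1, by rw [Polynomial.coeff_sub, coeff_one_add_X_pow_mul_self h1]⟩
  refine ⟨⟨m, hm⟩, fun i hi => ?_, ?_⟩
  · have hi' : (i : ℕ) < m := hi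
    simp only [familyWeight]
    congr 1
    ext c
    constructor
    · rintro ⟨hc, k, hk, hkc⟩
      obtain ⟨a, k', he⟩ := exists_eq_vdcFamily q r k
      dsimp only at hk hkc
      rw [he] at hk hkc
      obtain ⟨h1, h2⟩ := hlow i hi'.le a k' hk
      rw [h2, hqlow _ hi', sub_zero] at hkc
      exact ⟨hc, k', h1, hkc⟩
    · rintro ⟨hc, k, hk, hkc⟩
      have h1 : (vdcFamily L₀ L q r (Sum.inl k)).coeff i = c := by
        simp [vdcFamily, hkc, hqlow _ hi']
      refine ⟨hc, some ⟨Sum.inl k, i, i.2, by rw [h1]; exact hc⟩, fun j hj => ?_, h1⟩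
      change (k.elim L₀ L - q).coeff j = 0
      rw [Polynomial.coeff_sub, hqlow j (hj.trans hi'), sub_zero]
      exact hk j hj
  · have hqm : q.coeff m ∈ trailingCoeffs (fun k : Option ι => k.elim L₀ L) m :=
      ⟨hq, k₀, hqlow, rfl⟩
    have hsub : trailingCoeffs (fun k : Option (VdcIndex d L₀ L q r) =>
        k.elim ((1 + Polynomial.X) ^ r * L₀ - q) (fun x => vdcFamily L₀ L q r x)) m ⊆
        (fun c => c - q.coeff m) ''
          (trailingCoeffs (fun k : Option ι => k.elim L₀ L) m \ {q.coeff m}) := by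
      rintro c ⟨hc, k, hk, hkc⟩
      obtain ⟨a, k', he⟩ := exists_eq_vdcFamily q r k
      dsimp only at hk hkc
      rw [he] at hk hkc
      obtain ⟨h1, h2⟩ := hlow m le_rfl a k' hk
      rw [h2] at hkc
      obtain ⟨j, hj, hne⟩ := hmax k'
      have hjm : j = m := by
        by_contra hcon
        exact hne (h1 j (lt_of_le_of_ne hj hcon))
      subst hjm
      refine ⟨(k'.elim L₀ L).coeff j, ⟨⟨hne, k', h1, rfl⟩, fun heq => hc ?_⟩, hkc⟩
      rw [← hkc, show (k'.elim L₀ L).coeff j = q.coeff j from heq, sub_self]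
    have hfin := finite_trailingCoeffs (fun k : Option ι => k.elim L₀ L) m
    exact ((Set.ncard_le_ncard hsub (hfin.sdiff.image _)).trans
      (Set.ncard_image_le hfin.sdiff)).trans_lt (Set.ncard_sdiff_singleton_lt_of_mem hqm hfin)

/-- `ExponentCondition` is preserved by a van der Corput operation with a large shift. If the
subtracted member and the target have different coefficients of order `m₀`, the minimal order remains
`m₀`. Otherwise all these coefficients cancel, and the minimal order becomes `m₀ + 1`, where the new
target has the coefficient `r * L₀.coeff m₀`. -/
theorem ExponentCondition.vdcFamily (h : ExponentCondition d m₀ L₀ L) (hd : m₀ + 1 < d)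
    {k₀ : Option ι} (hk₀ : (k₀.elim L₀ L).coeff m₀ ≠ L₀.coeff m₀ ∨
      k₀ = none ∧ ∀ k : Option ι, (k.elim L₀ L).coeff m₀ = L₀.coeff m₀) {r : ℕ} (hr : 1 ≤ r)
    (hdist : ∀ x : Option ι ⊕ ι, ∃ j < d, (_root_.vdcFamily L₀ L (k₀.elim L₀ L) r x).coeff j ≠
      ((1 + Polynomial.X) ^ r * L₀ - k₀.elim L₀ L).coeff j) :
    ∃ m₁, ExponentCondition d m₁ ((1 + Polynomial.X) ^ r * L₀ - k₀.elim L₀ L)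
      (fun x : VdcIndex d L₀ L (k₀.elim L₀ L) r => _root_.vdcFamily L₀ L (k₀.elim L₀ L) r x) := by
  set q := k₀.elim L₀ L with hq
  have hqlow : ∀ j < m₀, q.coeff j = 0 := h.elim_low k₀
  have hlow : ∀ (a : ℕ) (k : Option ι), ∀ j < m₀,
      ((1 + Polynomial.X) ^ a * k.elim L₀ L - q).coeff j = 0 := fun a k j hj => by
    rw [Polynomial.coeff_sub, coeff_one_add_X_pow_mul_of_lt (h.elim_low k) a j hj, hqlow j hj,
      sub_zero]
  have hcoeff : ∀ (a : ℕ) (k : Option ι), ((1 + Polynomial.X) ^ a * k.elim L₀ L - q).coeff m₀ =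
      (k.elim L₀ L).coeff m₀ - q.coeff m₀ := fun a k => by
    rw [Polynomial.coeff_sub, coeff_one_add_X_pow_mul_self (h.elim_low k)]
  rcases hk₀ with hne | ⟨rfl, hall⟩
  · refine ⟨m₀, h.lt, hlow r none, ?_, fun x => ?_, fun x => x.2, fun x => hdist x⟩
    · exact (hcoeff r none).trans_ne (sub_ne_zero.2 hne.symm)
    · obtain ⟨a, k', he⟩ := exists_eq_vdcFamily q r (some x)
      intro j hj
      have := hlow a k' j hj
      rwa [← he] at this
  · have hlow' : ∀ (a : ℕ) (k : Option ι), ∀ j < m₀ + 1,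
        ((1 + Polynomial.X) ^ a * k.elim L₀ L - q).coeff j = 0 := by
      intro a k j hj
      rcases (Nat.lt_succ_iff.1 hj).lt_or_eq with hj' | rfl
      · exact hlow a k j hj'
      · rw [hcoeff, hall k]; exact sub_self _
    refine ⟨m₀ + 1, hd, hlow' r none, ?_, fun x => ?_, fun x => x.2, fun x => hdist x⟩
    · rw [Polynomial.coeff_sub, coeff_one_add_X_pow_mul_succ h.low_target]
      simp only [hq, Option.elim, add_sub_cancel_left]
      have : (r : ℤ) ≠ 0 := by exact_mod_cast (by omega : r ≠ 0)
      exact mul_ne_zero this h.lead_target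
    · obtain ⟨a, k', he⟩ := exists_eq_vdcFamily q r (some x)
      intro j hj
      have := hlow' a k' j hj
      rwa [← he] at this

end

section

variable {X : Type*} [MeasurableSpace X]

/-- The reduction of the exponents `diffOp L (m N)`, where the `(d + 1)`-th differences of `m N` are
bounded, to multiples of the `d`-th differences of `m N`, by induction on the weight. -/
theorem corrLE_diffOp {μ : Measure X} [IsProbabilityMeasure μ] {T : X ≃ᵐ X}
    (hT : MeasurePreserving T μ μ) {f : X → ℂ} (hf : BddBy 1 f) {d : ℕ} {m : ℕ → ℕ → ℤ} {C : ℤ}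
    (hm : ∀ᶠ N in atTop, ∀ n, |(fwdDiff 1)^[d + 1] (m N) n| ≤ C)
    (hlin : ∀ (κ : Type) [Fintype κ] (M₀ : ℤ) (M : κ → ℤ), Nonempty κ → (∀ i, M i ≠ M₀) →
      CorrLE μ T f (fun N n => M₀ * (fwdDiff 1)^[d] (m N) n)
        (fun i N n => M i * (fwdDiff 1)^[d] (m N) n) 0)
    (ι : Type) [Fintype ι] {m₀ : ℕ} {L₀ : Polynomial ℤ} {L : ι → Polynomial ℤ}
    (h : ExponentCondition (d + 1) m₀ L₀ L) :
    CorrLE μ T f (fun N => diffOp L₀ (m N))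
      (fun o : Option ι => o.elim (fun _ _ => 0) (fun i N => diffOp (L i) (m N))) 0 := by
  classical
  have hwf : WellFounded (Pi.Lex (ι := Fin (d + 1)) (β := fun _ => ℕ) (· < ·) (· < ·)) :=
    Pi.Lex.wellFounded _ fun _ => wellFounded_lt
  induction hw : familyWeight (d + 1) (fun k : Option ι => k.elim L₀ L) using hwf.induction
    generalizing ι m₀ L₀ L with
  | _ w ih =>
  subst hw
  rcases (Nat.lt_succ_iff.1 h.lt).lt_or_eq with hlt | rfl
  · obtain ⟨k₀, m₁, hm₁, hq, hqlow, hmax, hk₀⟩ := h.exists_pivot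
    set q := k₀.elim L₀ L with hqdef
    obtain ⟨r₀, hr₀, hdist⟩ := h.exists_shift_distinct (by omega) q
    refine CorrLE.of_vdcExponents hT hf r₀ fun r hr => ?_
    obtain ⟨m₂, h₂⟩ := h.vdcFamily (by omega) (hk₀.imp id fun h => ⟨h.1, h.2.2⟩) (hr₀.trans hr)
      (hdist r hr)
    have hIH := ih _ (familyWeight_vdcFamily_lt hm₁ hq hqlow hmax r) _ h₂ rfl
    -- all new exponents are translated by `q`, and the bounded ones are identified with `0`
    have hb : ∀ x : Option ι ⊕ ι, ∃ C' : ℤ, 0 ≤ C' ∧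
        ((¬ ∃ j < d + 1, (vdcFamily L₀ L q r x).coeff j ≠ 0) → ∀ m : ℕ → ℤ,
          (∀ n, |(fwdDiff 1)^[d + 1] m n| ≤ C) → ∀ n, |diffOp (vdcFamily L₀ L q r x) m n| ≤ C') := by
      intro x
      by_cases hx : ∃ j < d + 1, (vdcFamily L₀ L q r x).coeff j ≠ 0
      · exact ⟨0, le_rfl, fun h => absurd hx h⟩
      · push Not at hx
        obtain ⟨C', h0, hC'⟩ := exists_abs_diffOp_le_of_coeff hx C
        exact ⟨C', h0, fun _ => hC'⟩
    choose C' hC'0 hC' using hb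
    have hvdc : ∀ x N n, vdcExponents (fun N => diffOp L₀ (m N)) (fun i N => diffOp (L i) (m N)) r
        x N n = diffOp (vdcFamily L₀ L q r x) (m N) n + diffOp q (m N) n := by
      rintro ((_ | i) | i) N n
      · simp [vdcExponents, vdcFamily, diffOp_sub]
      · simp [vdcExponents, vdcFamily, diffOp_sub]
      · simp [vdcExponents, vdcFamily, diffOp_sub, diffOp_one_add_X_pow_mul]
    have hsum : 0 ≤ ∑ x, C' x := Finset.sum_nonneg fun x _ => hC'0 x
    refine CorrLE.of_approx hT hf (fun x => if hx : ∃ j < d + 1, (vdcFamily L₀ L q r x).coeff j ≠ 0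
      then some (⟨x, hx⟩ : VdcIndex (d + 1) L₀ L q r) else none) (fun N n => diffOp q (m N) n)
      (∑ x, C' x) ?_ ?_ hIH
    · refine Eventually.of_forall fun N n => ?_
      rw [diffOp_sub, diffOp_one_add_X_pow_mul, ← hqdef,
        show ∀ a b : ℤ, a - (a - b) - b = 0 by intros; ring, abs_zero]
      exact hsum
    · intro x
      filter_upwards [hm] with N hN n
      rw [hvdc]
      by_cases hx : ∃ j < d + 1, (vdcFamily L₀ L q r x).coeff j ≠ 0
      · rw [dif_pos hx]
        change |diffOp (vdcFamily L₀ L q r x) (m N) n + diffOp q (m N) n -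
          diffOp (vdcFamily L₀ L q r x) (m N) n - diffOp q (m N) n| ≤ _
        rw [add_sub_cancel_left, sub_self, abs_zero]
        exact hsum
      · rw [dif_neg hx]
        simp only [Option.elim, sub_zero, add_sub_cancel_right]
        exact (hC' x hx _ hN n).trans (Finset.single_le_sum (fun x _ => hC'0 x) (Finset.mem_univ x))
  -- if the target has order `d`, all exponents are multiples of the `d`-th differences, up to `O(1)`
  · set M : Option ι → ℤ := fun o => o.elim 0 (fun i => (L i).coeff m₀) with hM
    have hMne : ∀ o, M o ≠ L₀.coeff m₀ := by
      rintro (_ | i)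
      · exact h.lead_target.symm
      · obtain ⟨j, hj, hne⟩ := h.distinct i
        rcases (Nat.lt_succ_iff.1 hj).lt_or_eq with hj' | rfl
        · rw [h.low i j hj', h.low_target j hj'] at hne
          exact absurd rfl hne
        · exact hne
    obtain ⟨C₀, hC₀, hC₀'⟩ := exists_abs_diffOp_sub_le_of_coeff h.low_target C
    choose C' hC'0 hC' using fun i => exists_abs_diffOp_sub_le_of_coeff (h.low i) C
    have hsum : 0 ≤ ∑ i, C' i := Finset.sum_nonneg fun i _ => hC'0 i
    refine CorrLE.of_approx hT hf id (fun _ _ => 0) (C₀ + ∑ i, C' i) ?_ ?_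
      (hlin (Option ι) _ M inferInstance hMne)
    · filter_upwards [hm] with N hN n
      have := hC₀' _ hN n
      rw [sub_zero]
      linarith
    · rintro (_ | i)
      · refine Eventually.of_forall fun N n => ?_
        simp only [Option.elim, hM, id]
        simpa using add_nonneg hC₀ hsum
      · filter_upwards [hm] with N hN n
        have h1 := hC' i _ hN n
        have h2 := Finset.single_le_sum (fun i _ => hC'0 i) (Finset.mem_univ i)
        simp only [Option.elim, hM, id, sub_zero]
        linarith

end

/-! ### Leading coefficients of super nice sequences -/

section

open Polynomial

/-- If `Λ` commutes with differentiation and annihilates a polynomial of degree `e`, it annihilates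
all powers of `X` up to `e`. -/
theorem map_X_pow_eq_zero_of_commute_derivative {Λ : ℝ[X] →ₗ[ℝ] ℝ[X]}
    (hΛ : ∀ P, derivative (Λ P) = Λ (derivative P)) (e : ℕ) :
    ∀ P : ℝ[X], P ≠ 0 → P.natDegree = e → Λ P = 0 → ∀ i ≤ e, Λ (X ^ i) = 0 := by
  have hexp : ∀ (P : ℝ[X]) (e : ℕ), P.natDegree = e → (∀ i < e, Λ (X ^ i) = 0) →
      Λ P = P.leadingCoeff • Λ (X ^ e) := by
    intro P e he h
    conv_lhs => rw [P.as_sum_range_C_mul_X_pow, he, Finset.sum_range_succ]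
    rw [map_add, map_sum, Finset.sum_eq_zero, zero_add, ← smul_eq_C_mul, map_smul, leadingCoeff, he]
    intro i hi
    rw [← smul_eq_C_mul, map_smul, h i (Finset.mem_range.1 hi), smul_zero]
  induction e with
  | zero =>
    intro P hP hdeg h0 i hi
    obtain rfl : i = 0 := by omega
    rw [hexp P 0 hdeg (by simp)] at h0
    exact (smul_eq_zero.1 h0).resolve_left (leadingCoeff_ne_zero.2 hP)
  | succ e ih =>
    intro P hP hdeg h0 i hi
    have hd : (derivative P).natDegree = e := by
      rw [natDegree_derivative, hdeg, Nat.add_sub_cancel]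
    have hd0 : derivative P ≠ 0 := fun h => by
      have := derivative_eq_zero.1 h
      omega
    have hlow := ih (derivative P) hd0 hd (by rw [← hΛ, h0, derivative_zero])
    rcases hi.lt_or_eq with hlt | rfl
    · exact hlow i (by omega)
    · rw [hexp P (e + 1) hdeg fun i hi => hlow i (by omega)] at h0
      exact (smul_eq_zero.1 h0).resolve_left (leadingCoeff_ne_zero.2 hP)

/-- If `Λ` commutes with differentiation and lowers the degree of `P` to `1`, the leading coefficient
of `Λ P` is proportional to that of `P`: the lower terms of `P` only contribute to the constant
term. -/
theorem leadingCoeff_map_of_commute_derivative {Λ : ℝ[X] →ₗ[ℝ] ℝ[X]}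
    (hΛ : ∀ P, derivative (Λ P) = Λ (derivative P)) {P : ℝ[X]} {d : ℕ} (hd : 0 < d)
    (hP : P.natDegree = d) (hΛP : (Λ P).natDegree = 1) :
    (Λ P).leadingCoeff = (Λ (X ^ d)).coeff 1 * P.leadingCoeff := by
  have hlow : ∀ i, i + 2 ≤ d → Λ (X ^ i) = 0 := by
    intro i hi
    have hne : ∀ Q : ℝ[X], 0 < Q.natDegree → derivative Q ≠ 0 := fun Q hQ h => by
      have := derivative_eq_zero.1 h
      omega
    have h1 : (derivative P).natDegree = d - 1 := by rw [natDegree_derivative, hP]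
    refine map_X_pow_eq_zero_of_commute_derivative hΛ (d - 2) (derivative (derivative P))
      (hne _ (by omega)) (by rw [natDegree_derivative, h1]; omega) ?_ i (by omega)
    rw [← hΛ, ← hΛ]
    refine derivative_of_natDegree_zero ?_
    rw [natDegree_derivative, hΛP]
  have hcoeff : ∀ i < d, (Λ (X ^ i)).coeff 1 = 0 := by
    intro i hi
    have h1 : (derivative (Λ (X ^ i))).coeff 0 = (Λ (X ^ i)).coeff 1 := by
      rw [coeff_derivative]; simp
    rw [← h1, hΛ]
    rcases i with _ | i
    · simp
    · rw [derivative_X_pow, Nat.add_sub_cancel, ← smul_eq_C_mul, map_smul, hlow i (by omega)]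
      simp
  rw [leadingCoeff, hΛP]
  conv_lhs => rw [P.as_sum_range_C_mul_X_pow, hP, Finset.sum_range_succ]
  rw [map_add, map_sum, coeff_add, finsetSum_coeff, Finset.sum_eq_zero, zero_add,
    ← smul_eq_C_mul, map_smul, coeff_smul, leadingCoeff, hP, smul_eq_mul, mul_comm]
  intro i hi
  rw [← smul_eq_C_mul, map_smul, coeff_smul, hcoeff i (Finset.mem_range.1 hi), smul_zero]

theorem RProperty.exists_r1Property {N₀ l : ℕ} {a : Fin l → ℕ → ℝ} (h : RProperty N₀ l a) :
    ∃ i, R1Property N₀ (a i) := by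
  rcases l with _ | _ | l
  · exact h.elim
  · exact ⟨0, h⟩
  · exact ⟨0, (h 0).1⟩

/-- Van der Corput operations only produce images of `p N` under fixed operators commuting with
differentiation, so the growth of the final leading coefficients is that of the leading coefficient of
`p N`. -/
theorem ReducesToR.tendsto_leadingCoeff {p : ℕ → ℝ[X]} {d : ℕ} (hd : 0 < d)
    (hp : ∀ᶠ N in atTop, (p N).natDegree = d) (s : ℕ) :
    ∀ (l : ℕ) (P : Fin l → PolySeq), (∀ i, ∃ Λ : ℝ[X] →ₗ[ℝ] ℝ[X],
      (∀ Q, derivative (Λ Q) = Λ (derivative Q)) ∧ ∀ N, P i N = Λ (p N)) → ReducesToR s l P →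
      Tendsto (fun N : ℕ => |(p N).leadingCoeff| * N) atTop atTop := by
  induction s with
  | zero =>
    rintro l P hP ⟨hlin, N₀, hR⟩
    obtain ⟨i, -, -, -, hi⟩ := hR.exists_r1Property
    obtain ⟨Λ, hΛ, hPΛ⟩ := hP i
    set K := (Λ (X ^ d)).coeff 1
    have h1 : Tendsto (fun N : ℕ => |K| * (|(p N).leadingCoeff| * N)) atTop atTop := by
      refine hi.congr' ?_
      filter_upwards [hlin i, hp] with N hN hpN
      rw [hPΛ] at hN ⊢
      rw [leadingCoeff_map_of_commute_derivative hΛ hd hpN hN, abs_mul, mul_assoc]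
    rcases eq_or_ne K 0 with hK | hK
    · simp only [hK, abs_zero, zero_mul] at h1
      exact absurd h1 (not_tendsto_const_atTop _ _)
    · exact (tendsto_const_mul_atTop_of_pos (abs_pos.2 hK)).1 h1
  | succ s ih =>
    rintro l P hP ⟨-, j, hj⟩
    obtain ⟨h, k, Q, hQ, hred⟩ := hj.exists
    refine ih k Q (fun m => ?_) hred
    obtain ⟨Λj, hΛj, hPj⟩ := hP j
    obtain ⟨i, hi⟩ := hQ.mem m
    obtain ⟨Λi, hΛi, hPi⟩ := hP i
    rcases hi with hi | hi
    · refine ⟨(taylor (h : ℝ)) ∘ₗ Λi - Λj, fun R => ?_, fun N => ?_⟩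
      · simp only [LinearMap.sub_apply, LinearMap.comp_apply, derivative_sub, hΛj, ← hΛi]
        rw [taylor_apply, taylor_apply, derivative_comp]
        simp
      · simp only [hi, hPi, hPj]; simp [taylor_apply]
    · refine ⟨Λi - Λj, fun R => by simp [hΛi, hΛj], fun N => ?_⟩
      simp only [hi, hPi, hPj]; simp

theorem SuperNice.exists_degree {l : ℕ} {p : ℕ → ℝ[X]}
    (hp : SuperNice (fun (i : Fin l) (N : ℕ) => ((i : ℝ) + 1) • p N)) (hl : 0 < l) :
    ∃ (d : ℕ) (A : ℝ), (∀ᶠ N in atTop, (p N).natDegree = d + 1) ∧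
      (∀ N, |(p N).leadingCoeff| ≤ A) ∧
      Tendsto (fun N : ℕ => |(p N).leadingCoeff| * N) atTop atTop := by
  obtain ⟨d, hd0, hd⟩ := hp.degree ⟨0, hl⟩
  obtain ⟨A, hA⟩ := hp.bounded_coeff
  simp only [Nat.cast_zero, zero_add, one_smul] at hd
  obtain ⟨s, hs⟩ := hp.reduction
  refine ⟨d - 1, A, by simpa [Nat.sub_add_cancel hd0] using hd, fun N => ?_,
    ReducesToR.tendsto_leadingCoeff hd0 hd s l _ (fun i =>
      ⟨((i : ℝ) + 1) • LinearMap.id, fun Q => by simp, fun N => by simp⟩) hs⟩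
  simpa using hA ⟨0, hl⟩ N (p N).natDegree

end

/-! ### Differences of integer parts of polynomials -/

theorem abs_fwdDiff_iter_le {z : ℕ → ℝ} (hz : ∀ n, |z n| ≤ 1) (k : ℕ) :
    ∀ n, |(fwdDiff 1)^[k] z n| ≤ 2 ^ k := by
  induction k with
  | zero => intro n; simpa using hz n
  | succ k ih =>
    intro n
    rw [Function.iterate_succ_apply', fwdDiff, pow_succ]
    refine (abs_sub _ _).trans ?_
    linarith [ih (n + 1), ih n]

theorem cast_fwdDiff_iter (m : ℕ → ℤ) (k n : ℕ) :
    (((fwdDiff 1)^[k] m n : ℤ) : ℝ) = (fwdDiff 1)^[k] (fun n => (m n : ℝ)) n := by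
  simp only [fwdDiff_iter_eq_sum_shift]
  push_cast
  simp

theorem abs_cast_fwdDiff_iter_floor_sub_le (x : ℕ → ℝ) (k n : ℕ) :
    |(((fwdDiff 1)^[k] (fun n => ⌊x n⌋) n : ℤ) : ℝ) - (fwdDiff 1)^[k] x n| ≤ 2 ^ k := by
  have h1 := abs_fwdDiff_iter_le (z := fun n => Int.fract (x n))
    (fun n => by rw [abs_of_nonneg (Int.fract_nonneg _)]; exact (Int.fract_lt_one _).le) k n
  rw [cast_fwdDiff_iter, abs_sub_comm]
  have h2 : x = (fun n => (⌊x n⌋ : ℝ)) + fun n => Int.fract (x n) := by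
    ext n; exact (Int.floor_add_fract (x n)).symm
  conv_lhs => rw [h2, fwdDiff_iter_add]
  simpa using h1

theorem fwdDiff_iter_eval_add_one (P : Polynomial ℝ) (n : ℕ) :
    (fwdDiff 1)^[P.natDegree] (fun n : ℕ => P.eval ((n : ℝ) + 1)) n =
      P.leadingCoeff * P.natDegree.factorial := by
  have h := congrFun P.fwdDiff_iter_degree_eq_factorial ((n : ℝ) + 1)
  rw [fwdDiff_iter_eq_sum_shift] at h ⊢
  rw [Pi.smul_apply, smul_eq_mul] at h
  refine Eq.trans (Finset.sum_congr rfl fun k _ => ?_) h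
  congr 2
  simp; ring

theorem fwdDiff_iter_eq_linear {x : ℕ → ℝ} {d : ℕ} {α : ℝ}
    (h : ∀ n, (fwdDiff 1)^[d + 1] x n = α) (n : ℕ) :
    (fwdDiff 1)^[d] x n = α * n + (fwdDiff 1)^[d] x 0 := by
  induction n with
  | zero => simp
  | succ n ih =>
    have h1 := h n
    rw [Function.iterate_succ_apply', fwdDiff] at h1
    push_cast
    linarith

/-! ### Multiple averages along integer parts -/

section

variable {X : Type*} [MeasurableSpace X]

/-- Correlations along linear exponents remain negligible along multiples of a sequence of the form
`α N * n + β N + O(1)`. -/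
theorem corrLE_mul_of_condExp_nilfactor {μ : Measure X} [IsProbabilityMeasure μ] {T : X ≃ᵐ X}
    (hT : MeasurePreserving T μ μ) {B : ℝ} {f : X → ℂ} (hf : BddBy B f)
    (hf0 : μ[f | nilfactor μ T] =ᵐ[μ] 0) {u : ℕ → ℕ → ℤ} {α β : ℕ → ℝ} {A C : ℝ}
    (hA : ∀ᶠ N in atTop, |α N| ≤ A) (hα : Tendsto (fun N : ℕ => |α N| * N) atTop atTop)
    (hu : ∀ᶠ N in atTop, ∀ n : ℕ, |(u N n : ℝ) - α N * n - β N| ≤ C)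
    {κ : Type*} [Fintype κ] [Nonempty κ] {M₀ : ℤ} {M : κ → ℤ} (hM : ∀ i, M i ≠ M₀) :
    CorrLE μ T f (fun N n => M₀ * u N n) (fun i N n => M i * u N n) 0 := by
  obtain ⟨k, hk⟩ := Nat.exists_eq_succ_of_ne_zero (Fintype.card_ne_zero (α := κ))
  set φ := Fintype.equivFinOfCardEq hk
  refine CorrLE.of_linear hT hf ?_ hA hα hu
  refine CorrLE.of_approx hT hf φ (fun _ _ => 0) 0 (Eventually.of_forall fun N n => by simp)
    (fun i => Eventually.of_forall fun N n => ?_)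
    (corrLE_zero_of_condExp_nilfactor hT hf hf0 (M := fun j => M (φ.symm j)) fun j => hM _)
  simp

/-- Correlations along distinct nonzero multiples of `⌊p N (n + 1)⌋` are negligible if one of the
functions is orthogonal to the nilfactor. The exponent `0` is included in the family. -/
theorem corrLE_floor_eval {μ : Measure X} [IsProbabilityMeasure μ] {T : X ≃ᵐ X}
    (hT : MeasurePreserving T μ μ) {f : X → ℂ} (hf : BddBy 1 f)
    (hf0 : μ[f | nilfactor μ T] =ᵐ[μ] 0) {p : ℕ → Polynomial ℝ} {d : ℕ} {A : ℝ}
    (hd : ∀ᶠ N in atTop, (p N).natDegree = d + 1) (hA : ∀ N, |(p N).leadingCoeff| ≤ A)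
    (hlim : Tendsto (fun N : ℕ => |(p N).leadingCoeff| * N) atTop atTop)
    {ι : Type} [Fintype ι] {a₀ : ℤ} {a : ι → ℤ} (ha₀ : a₀ ≠ 0) (ha : ∀ i, a i ≠ 0)
    (hne : ∀ i, a i ≠ a₀) :
    CorrLE μ T f (fun N n => a₀ * ⌊(p N).eval ((n : ℝ) + 1)⌋)
      (fun o : Option ι => o.elim (fun _ _ => 0)
        (fun i N n => a i * ⌊(p N).eval ((n : ℝ) + 1)⌋)) 0 := by
  set x : ℕ → ℕ → ℝ := fun N n => (p N).eval ((n : ℝ) + 1) with hx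
  set m : ℕ → ℕ → ℤ := fun N n => ⌊x N n⌋ with hm
  set K : ℝ := ((d + 1).factorial : ℝ) with hK
  have hK0 : 0 < K := by positivity
  have hdiff : ∀ᶠ N in atTop, ∀ n, (fwdDiff 1)^[d + 1] (x N) n = (p N).leadingCoeff * K := by
    filter_upwards [hd] with N hN n
    have := fwdDiff_iter_eval_add_one (p N) n
    rwa [hN] at this
  have hbd : ∀ᶠ N in atTop, ∀ n, |(fwdDiff 1)^[d + 1] (m N) n| ≤ ⌈A * K + 2 ^ (d + 1)⌉ := by
    filter_upwards [hdiff] with N hN n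
    have h1 := abs_cast_fwdDiff_iter_floor_sub_le (x N) (d + 1) n
    rw [hN] at h1
    have h2 : |(p N).leadingCoeff * K| ≤ A * K := by
      rw [abs_mul, abs_of_pos hK0]
      exact mul_le_mul_of_nonneg_right (hA N) hK0.le
    have h3 : |(((fwdDiff 1)^[d + 1] (m N) n : ℤ) : ℝ)| ≤ A * K + 2 ^ (d + 1) := by
      calc _ = |((((fwdDiff 1)^[d + 1] (m N) n : ℤ) : ℝ) - (p N).leadingCoeff * K)
            + (p N).leadingCoeff * K| := by rw [sub_add_cancel]
        _ ≤ _ := (abs_add_le _ _).trans (by linarith)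
    have h4 := h3.trans (Int.le_ceil _)
    exact_mod_cast h4
  have hlin : ∀ (κ : Type) [Fintype κ] (M₀ : ℤ) (M : κ → ℤ), Nonempty κ → (∀ i, M i ≠ M₀) →
      CorrLE μ T f (fun N n => M₀ * (fwdDiff 1)^[d] (m N) n)
        (fun i N n => M i * (fwdDiff 1)^[d] (m N) n) 0 := by
    intro κ _ M₀ M _ hM
    refine corrLE_mul_of_condExp_nilfactor hT hf hf0 (α := fun N => (p N).leadingCoeff * K)
      (β := fun N => (fwdDiff 1)^[d] (x N) 0) (A := A * K) (C := 2 ^ d)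
      (Eventually.of_forall fun N => ?_) ?_ ?_ hM
    · rw [abs_mul, abs_of_pos hK0]
      exact mul_le_mul_of_nonneg_right (hA N) hK0.le
    · refine (hlim.const_mul_atTop hK0).congr fun N => ?_
      rw [abs_mul, abs_of_pos hK0]; ring
    · filter_upwards [hdiff] with N hN n
      have h1 := abs_cast_fwdDiff_iter_floor_sub_le (x N) d n
      rw [fwdDiff_iter_eq_linear hN n] at h1
      rwa [sub_sub]
  have hcond : ExponentCondition (d + 1) 0 (Polynomial.C a₀) (fun i => Polynomial.C (a i)) :=
    ⟨Nat.succ_pos d, fun j hj => absurd hj (Nat.not_lt_zero j), by simpa using ha₀,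
      fun i j hj => absurd hj (Nat.not_lt_zero j), fun i => ⟨0, Nat.succ_pos d, by simpa using ha i⟩,
      fun i => ⟨0, Nat.succ_pos d, by simpa [sub_eq_zero] using hne i⟩⟩
  refine CorrLE.of_approx hT hf id (fun _ _ => 0) 0 (Eventually.of_forall fun N n => ?_)
    (fun o => Eventually.of_forall fun N n => ?_) (corrLE_diffOp hT hf hbd hlin ι hcond)
  · simp [diffOp_C, hm, hx, -eq_intCast]
  · cases o <;> simp [diffOp_C, hm, hx, -eq_intCast]

/-- Convergence to zero in mean square for functions bounded by `1`. The square of the norm of the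
average is a correlation of the functions with the conjugate of the average itself, which takes the
exponent `0`. -/
theorem tendsto_integral_sq_norm_avg {μ : Measure X} [IsProbabilityMeasure μ] {T : X ≃ᵐ X}
    (hT : MeasurePreserving T μ μ) {l : ℕ} {p : ℕ → Polynomial ℝ}
    (hp : SuperNice (fun (i : Fin l) (N : ℕ) => ((i : ℝ) + 1) • p N))
    {f : Fin l → X → ℂ} (hf : ∀ i, BddBy 1 (f i)) {i₀ : Fin l}
    (hf0 : μ[f i₀ | nilfactor μ T] =ᵐ[μ] 0) :
    Tendsto (fun N : ℕ => ∫ x, ‖(1 / (N : ℂ)) * ∑ n ∈ Finset.Icc 1 N, ∏ i : Fin l,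
      f i (intIterate T (((i : ℤ) + 1) * ⌊(p N).eval (n : ℝ)⌋) x)‖ ^ 2 ∂μ) atTop (𝓝 0) := by
  obtain ⟨d, A, hd, hA, hlim⟩ := hp.exists_degree (Fin.pos i₀)
  have hcorr := corrLE_floor_eval hT (hf i₀) hf0 hd hA hlim (ι := {i : Fin l // i ≠ i₀})
    (a₀ := (i₀ : ℤ) + 1) (a := fun i => (i.1 : ℤ) + 1) (by positivity) (fun i => by positivity)
    (fun i h => i.2 (Fin.ext (by simpa using h)))
  rw [Metric.tendsto_nhds]
  intro ε hε
  filter_upwards [hcorr (ε / 2) (by positivity)] with N hN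
  set F : ℕ → X → ℂ := fun n x => ∏ i : Fin l,
    f i (intIterate T (((i : ℤ) + 1) * ⌊(p N).eval ((n : ℝ) + 1)⌋) x) with hF
  have hFb : ∀ n, BddBy 1 (F n) := fun n => BddBy.prod _ fun i _ => (hf i).comp_intIterate hT _
  set S : X → ℂ := fun x => (1 / (N : ℂ)) * ∑ n ∈ Finset.range N, F n x with hS
  have hSb : BddBy 1 S := by
    have h1 := (BddBy.sum (Finset.range N) fun n _ => hFb n).const_mul
      (c := 1 / (N : ℝ)) (w := 1 / (N : ℂ)) (by simp)
    refine ⟨h1.1, fun x => (h1.2 x).trans ?_⟩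
    rw [Finset.card_range, mul_one]
    rcases N.eq_zero_or_pos with rfl | hN0
    · simp
    · rw [one_div_mul_cancel (by exact_mod_cast hN0.ne')]
  have hIcc : ∀ x, (1 / (N : ℂ)) * ∑ n ∈ Finset.Icc 1 N, ∏ i : Fin l,
      f i (intIterate T (((i : ℤ) + 1) * ⌊(p N).eval (n : ℝ)⌋) x) = S x := by
    intro x
    simp only [hS, hF]
    congr 1
    rw [Finset.range_eq_Ico, ← Finset.Ico_add_one_right_eq_Icc]
    rw [← Finset.sum_Ico_add' _ 0 N 1]
    simp
  simp only [hIcc]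
  have hint : ((∫ x, ‖S x‖ ^ 2 ∂μ : ℝ) : ℂ) =
      (1 / (N : ℂ)) * ∑ n ∈ Finset.range N, ∫ x, F n x * conj (S x) ∂μ := by
    rw [← integral_finsetSum _ fun n _ => ((hFb n).mul hSb.conj).integrable μ,
      ← integral_const_mul, ← integral_complex_ofReal]
    congr 1
    ext x
    rw [← Finset.sum_mul, ← mul_assoc]
    change _ = S x * conj (S x)
    rw [Complex.mul_conj']
    push_cast
    rfl
  have hle : ∫ x, ‖S x‖ ^ 2 ∂μ ≤
      (1 / (N : ℝ)) * ∑ n ∈ Finset.range N, ‖∫ x, F n x * conj (S x) ∂μ‖ := by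
    have h0 : 0 ≤ ∫ x, ‖S x‖ ^ 2 ∂μ := integral_nonneg fun x => by positivity
    rw [← Real.norm_of_nonneg h0, ← Complex.norm_real, hint, norm_mul]
    have : ‖(1 / (N : ℂ))‖ = 1 / (N : ℝ) := by simp
    rw [this]
    gcongr
    exact norm_sum_le _ _
  have hcor := hN (fun o : Option {i : Fin l // i ≠ i₀} => o.elim (fun x => conj (S x))
    (fun i => f i.1)) (by
      rintro (_ | i)
      · exact hSb.conj
      · exact hf i.1)
  have heq : ∀ (n : ℕ) (x : X), f i₀ (intIterate T (((i₀ : ℤ) + 1) * ⌊(p N).eval ((n : ℝ) + 1)⌋) x) *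
      ∏ o : Option {i : Fin l // i ≠ i₀}, (o.elim (fun x => conj (S x)) (fun i => f i.1) : X → ℂ)
        (intIterate T ((o.elim (fun _ _ => 0) (fun i N n =>
          ((i.1 : ℤ) + 1) * ⌊(p N).eval ((n : ℝ) + 1)⌋) : ℕ → ℕ → ℤ) N n) x) =
      F n x * conj (S x) := by
    intro n x
    rw [Fintype.prod_option]
    simp only [Option.elim, intIterate_zero, hF]
    rw [Fintype.prod_eq_mul_prod_subtype_ne _ i₀]
    ring
  simp only [heq] at hcor
  rw [dist_zero_right, Real.norm_of_nonneg (integral_nonneg fun x => by positivity)]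
  linarith [hle.trans hcor]

end

theorem corollary4p6 {X : Type*} [MeasurableSpace X] [StandardBorelSpace X]
    (μ : Measure X) [IsProbabilityMeasure μ] (T : X ≃ᵐ X) (hT : MeasurePreserving T μ μ)
    (l : ℕ) (p : ℕ → Polynomial ℝ)
    (hp : SuperNice (fun (i : Fin l) (N : ℕ) => ((i : ℝ) + 1) • p N))
    (f : Fin l → X → ℂ) (hf : ∀ i, MemLp (f i) ∞ μ)
    (horth : ∃ i, μ[f i | nilfactor μ T] =ᵐ[μ] 0) :
    Tendsto (fun N : ℕ => eLpNorm (fun x => (1 / (N : ℂ)) * ∑ n ∈ Finset.Icc 1 N,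
      ∏ i : Fin l,
        f i (((T.toEquiv : Equiv.Perm X) ^ (((i : ℤ) + 1) * ⌊(p N).eval (n : ℝ)⌋)) x)) 2 μ)
      atTop (𝓝 0) := by
  obtain ⟨i₀, hi₀⟩ := horth
  choose B f' hf' hae using fun i => exists_bddBy_ae_eq (hf i)
  -- rescale to functions bounded by `1`
  set b : Fin l → ℂ := fun i => ((|B i| + 1 : ℝ) : ℂ) with hb
  have hb0 : ∀ i, b i ≠ 0 := fun i => by
    have : (|B i| + 1 : ℝ) ≠ 0 := by positivity
    exact Complex.ofReal_ne_zero.2 this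
  set g : Fin l → X → ℂ := fun i x => (b i)⁻¹ * f' i x with hg
  have hgb : ∀ i, BddBy 1 (g i) := fun i => by
    refine ⟨measurable_const.mul (hf' i).1, fun x => ?_⟩
    have h1 : (0 : ℝ) < |B i| + 1 := by positivity
    rw [norm_mul, norm_inv, hb, Complex.norm_real, Real.norm_of_nonneg h1.le,
      inv_mul_le_one₀ h1]
    linarith [(hf' i).2 x, le_abs_self (B i)]
  have hg0 : μ[g i₀ | nilfactor μ T] =ᵐ[μ] 0 := by
    have h1 : μ[g i₀ | nilfactor μ T] =ᵐ[μ] (b i₀)⁻¹ • μ[f' i₀ | nilfactor μ T] :=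
      condExp_smul (b i₀)⁻¹ (f' i₀) _
    filter_upwards [h1, condExp_congr_ae (m := nilfactor μ T) (hae i₀), hi₀] with x hx1 hx2 hx3
    rw [hx1, Pi.smul_apply, ← hx2, hx3]
    simp
  have hmain := tendsto_integral_sq_norm_avg hT hp hgb hg0
  set A : ℕ → X → ℂ := fun N x => (1 / (N : ℂ)) * ∑ n ∈ Finset.Icc 1 N, ∏ i : Fin l,
      g i (intIterate T (((i : ℤ) + 1) * ⌊(p N).eval (n : ℝ)⌋) x) with hA
  have hAb : ∀ N, ∃ D, BddBy D (A N) := fun N =>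
    ⟨_, (BddBy.sum (Finset.Icc 1 N) fun n _ =>
      BddBy.prod Finset.univ fun i _ => (hgb i).comp_intIterate hT _).const_mul le_rfl⟩
  have hnorm : ∀ N, eLpNorm (A N) 2 μ = ENNReal.ofReal ((∫ x, ‖A N x‖ ^ 2 ∂μ) ^ ((2 : ℝ)⁻¹)) := by
    intro N
    obtain ⟨D, hD⟩ := hAb N
    have h2 : MemLp (A N) 2 μ :=
      MemLp.of_bound hD.1.aestronglyMeasurable D (ae_of_all _ hD.2)
    rw [h2.eLpNorm_eq_integral_rpow_norm two_ne_zero ENNReal.ofNat_ne_top]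
    simp
  have hAlim : Tendsto (fun N => eLpNorm (A N) 2 μ) atTop (𝓝 0) := by
    simp only [hnorm]
    have h1 := (hmain.rpow_const (p := (2 : ℝ)⁻¹) (Or.inr (by norm_num)))
    rw [Real.zero_rpow (by norm_num)] at h1
    have h2 := ENNReal.tendsto_ofReal h1
    rwa [ENNReal.ofReal_zero] at h2
  have heq : ∀ N : ℕ, eLpNorm (fun x => (1 / (N : ℂ)) * ∑ n ∈ Finset.Icc 1 N, ∏ i : Fin l,
        f i (((T.toEquiv : Equiv.Perm X) ^ (((i : ℤ) + 1) * ⌊(p N).eval (n : ℝ)⌋)) x)) 2 μ =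
      ‖∏ i, b i‖ₑ * eLpNorm (A N) 2 μ := by
    intro N
    rw [← eLpNorm_const_smul]
    refine eLpNorm_congr_ae ?_
    have h1 : ∀ (i : Fin l) (k : ℤ), ∀ᵐ x ∂μ, f i (intIterate T k x) = f' i (intIterate T k x) :=
      fun i k => (measurePreserving_intIterate hT k).quasiMeasurePreserving.ae (hae i)
    filter_upwards [ae_all_iff.2 fun i => ae_all_iff.2 (h1 i)] with x hx
    simp only [hA, Pi.smul_apply, smul_eq_mul]
    rw [mul_left_comm, Finset.mul_sum (Finset.Icc 1 N) _ (∏ i, b i)]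
    congr 1
    refine Finset.sum_congr rfl fun n _ => ?_
    rw [← Finset.prod_mul_distrib]
    refine Finset.prod_congr rfl fun i _ => ?_
    simp only [hg]
    rw [mul_inv_cancel_left₀ (hb0 i), ← hx i]
    rfl
  simp only [heq]
  simpa using ENNReal.Tendsto.const_mul hAlim (Or.inr enorm_ne_top)
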